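/- **Model.** Alice (strategic), Bob (basic selfish miner) and Henry (honest) have Hash powers $\alpha_1,\alpha_2,\alpha_h>0$ with $\alpha_1+\alpha_2+\alpha_h=1$. Time is slotted; in a slot a block is mined with probability $p\in(0,1]$, and it is Alice's, Bob's, Henry's with probabilities $\alpha_1,\alpha_2,\alpha_h$. Further parameters are $\gamma_1,\gamma_2\in[0,1]$ with $\gamma_1+\gamma_2>0$, $\beta_i=\gamma_i/(\gamma_1+\gamma_2)$, $\theta_1,\theta_2\ge 0$ with $\theta_1+\theta_2\le1$, length limits $N,H\ge1$ ($H=h_{3,\max}$), and a weight $\rho\in[0,1]$. *States.* $\mathcal S$ is the finite set of tuples $s=\langle loc,fork,l_1,l_2,h_1,h_2,h_3,\mu_1,\mu_2,\mu_3\rangle$ with $loc\in\{1,2,3\}$, $fork\in\{ir,r,f_{12},f_{13},f_{23},f_{123}\}$ and natural numbers $l_1,l_2\le N$, $h_1,h_2\le h_3\le H$, $\mu_i\le h_i$, $h_3\le l_2+h_2$, and $l_2=0$ if $l_2+h_2=h_3$. Here $l_1,l_2$ count the unreleased blocks of Alice and Bob, $h_1,h_2$ are the distances between the starting positions believed by Alice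 and Bob and the real starting position, $h_3$ is the length of the public chain, and $\mu_i$ counts Henry's blocks among these $h_i$ blocks. Let $s_0=\langle 3,ir,0,\dots,0\rangle$. *Observations.* In state $s$ Alice observes, with certainty, $o(s)=\langle fork,l_1,h_1,h_3,\mu_1\rangle$. *Actions.* *adopt*, or releasing $a\in\{0,\dots,l_1\}$ blocks, where $a\ge1$ is required if $l_1=N$, and $a\ge h_3-h_1$ is required if $h_3=H$. *Transitions and rewards.* Write $\Delta=l_2+h_2-h_3$, $k=h_3-h_2$, $m=l_1-a$, $h=h_1+a$, $L=l_2+h_2$. Rewards are triples (Alice, Bob, Henry). "$[w]\ X_0\,;X_1\,;X_2\,;X_h$" means: reward $w$, and next tuple $X_0,X_1,X_2,X_h$ with probabilities $1-p,\ \alpha_1p,\ \alpha_2p,\ \alpha_hp$. If one of the three mining events is split, its branches are listed with their conditional probabilities, and a reward written after a tuple replaces $w$. Tuples list the components in the order above; $f$ is the current fork. $0^j$ is a block of $j$ zeros. Put $w_1=(h-\mu_1,0,\mu_1)$ and $0=(0,0,0)$. Action *adopt*: - $\Delta\ge2$, $loc\ne2$: $[0]\ (loc,ir,0,l_2,h_3,h_2,h_3,\mu_3,\mu_2,\mu_3);\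 (1,ir,1,l_2,h_3,h_2,h_3,\mu_3,\mu_2,\mu_3);\ (1,ir,0,l_2+1,h_3,h_2,h_3,\mu_3,\mu_2,\mu_3);\ X_h$, with $X_h=(1,r,0,l_2,h_3,h_2,h_3+1,\mu_3,\mu_2,\mu_3+1)$ if $\Delta>2$ and $X_h=(2,r,0,0,h_3,L,L,\mu_3,\mu_2,\mu_2)$ if $\Delta=2$. - $\Delta\ge2$, $loc=2$: $[(0,h_2-\mu_2,\mu_2)]\ (3,ir,0,l_2,k,0,k,k,0,k);\ (1,ir,1,l_2,k,0,k,k,0,k);\ (1,ir,0,l_2+1,k,0,k,k,0,k);\ X_h$, with $X_h=(1,r,0,l_2,k,0,k+1,k,0,k+1)$ if $\Delta>2$ and $X_h=(2,r,0,0,k,l_2,l_2,k,0,0)$ if $\Delta=2$. - $\Delta=1$: $[(0,h_2-\mu_2,\mu_2)]\ (1,ir,0,l_2,k,0,k,k,0,k);\ (1,ir,1,l_2,k,0,k,k,0,k);\ (1,ir,0,l_2+1,k,0,k,k,0,k);\ (loc,f_{23},0,0,k,k+1,k+1,0,0,1)$. - $\Delta=0$, $f\in\{f_{23},f_{123}\}$: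 idle: if $loc=2$, $(2,f_{23},0,l_2,0,d,d,0,0,d)$ with $d=\max(\mu_3-\mu_2,0)$ and reward $(0,h_3-\mu_3,\mu_2)$; otherwise $(loc,f_{23},0,l_2,h_3,h_2,h_3,\mu_3,\mu_2,\mu_3)$ with reward $0$. Alice mines: with $\gamma_2$, $(1,ir,0^8)$, reward $(1,h_2-\mu_2,\mu_2)$; with $1-\gamma_2$, $(3,ir,0^8)$, reward $(1,h_3-\mu_3,\mu_3)$ if $loc=2$ and $(1+h_3-\mu_3,0,\mu_3)$ otherwise. Bob mines: $(2,ir,0^8)$, reward $(0,h_2+1-\mu_2,\mu_2)$. Henry mines: with $\gamma_2$, $(2,r,0^8)$, reward $(0,h_2-\mu_2,\mu_2+1)$; with $1-\gamma_2$, $(3,r,0^8)$, reward $(0,h_3-\mu_3,\mu_3+1)$ if $loc=2$ and $(h_3-\mu_3,0,\mu_3+1)$ otherwise. - $\Delta=0$, other forks: $[w]\ (3,ir,0^8);\ (3,ir,1,0^7);\ (3,ir,0,1,0^6);\ (3,r,0,0,0,1,1,0,1,1)$, with $w=(0,h_2-\mu_2,\mu_2)$ if $f=f_{12}$ or ($f\in\{r,ir\}$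 and $loc=2$), and $w=(h_3-\mu_3,0,\mu_3)$ otherwise. Action "release $a$": - $h>L$: $[w_1]\ (3,ir,m,0^7);\ (3,ir,m+1,0^7);\ (3,ir,m,1,0^6);\ (3,r,m,0,0,1,1,0,1,1)$. - $\Delta\ge1$, $h=L$: $[0]\ (loc,f_{12},m,0,h,L,L,\mu_1,\mu_2,\mu_3);\ (loc,f_{12},m+1,0,h,L,L,\mu_1,\mu_2,\mu_3);\ (2,r,m,0,h,L+1,L+1,\mu_1,\mu_2,\mu_2);$ Henry: with $\beta_2$, $(2,r,m,0,h,L+1,L+1,\mu_1,\mu_2+1,\mu_2+1)$; with $\beta_1$, $(2,r,m,0,0,1,1,0,1,1)$, reward $w_1$. - $\Delta\ge2$, $h_3<h=L-1$: $[0]\ (2,ir,m,0,h,L,L,\mu_1,\mu_2,\mu_2);\ (2,r,m+1,0,h,L,L,\mu_1,\mu_2,\mu_2);\ (2,r,m,1,h,L,L,\mu_1,\mu_2,\mu_2);\ (2,r,m,0,h,L+1,L+1,\mu_1,\mu_2+1,\mu_2+1)$. - $\Delta>2$, $h_3<h<L-1$: $[0]\ (1,ir,m,l_2,h,h_2,h,\mu_1,\mu_2,\mu_1);\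 (1,ir,m+1,l_2,h,h_2,h,\mu_1,\mu_2,\mu_1);\ (1,ir,m,l_2+1,h,h_2,h,\mu_1,\mu_2,\mu_1);\ (1,r,m,l_2,h,h_2,h+1,\mu_1,\mu_2,\mu_1+1)$. - $\Delta\ge2$, $h=h_3$, and ($f=r$, $a>0$) or ($f=f_{13}$, $a=0$): $[0]\ (loc,f_{13},m,l_2,h_3,h_2,h_3,\mu_1,\mu_2,\mu_3);\ (loc,f_{13},m+1,l_2,h_3,h_2,h_3,\mu_1,\mu_2,\mu_3);\ (loc,f_{13},m,l_2+1,h_3,h_2,h_3,\mu_1,\mu_2,\mu_3);$ Henry: if $\Delta=2$, $(2,r,m,0,h,L,L,\mu_1,\mu_2,\mu_2)$; if $\Delta>2$, with $\gamma_1$, $(1,r,m,l_2,h_3,h_2,h_3+1,\mu_1,\mu_2,\mu_1+1)$, with $1-\gamma_1$, $(loc,r,m,l_2,h_3,h_2,h_3+1,\mu_1,\mu_2,\mu_3+1)$. - All other cases with $\Delta\ge1$, $h\le h_3$: $[0]\ (loc,ir,m,l_2,h,h_2,h_3,\mu_1,\mu_2,\mu_3);\ (loc,ir,m+1,l_2,h,h_2,h_3,\mu_1,\mu_2,\mu_3);\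 (loc,ir,m,l_2+1,h,h_2,h_3,\mu_1,\mu_2,\mu_3);\ X_h$, with $X_h=(loc,r,m,l_2,h,h_2,h_3+1,\mu_1,\mu_2,\mu_3+1)$ if $\Delta>2$, $X_h=(2,r,m,0,h,L,L,\mu_1,\mu_2,\mu_2)$ if $\Delta=2$, and $X_h=(loc,f_{23},m,0,h,h_3+1,h_3+1,\mu_1,\mu_2,\mu_3+1)$ if $\Delta=1$. - $\Delta=0$, $a>0$, $h=h_3$, $f\in\{f_{23},r\}$: set $g=f_{123}$ if $f=f_{23}$; $g=f_{13}$ if $f=r$, $h_2=\mu_2$; $g=f_{12}$ if $f=r$, $h_2\ne\mu_2$. Idle: $(loc,g,m,l_2,h,h_2,h_3,\mu_1,\mu_2,\mu_3)$; Alice: the same with $m+1$; both with reward $0$. With $Y(x)=(2,r,m,l_2,h,h_2+1,h_3+1,\mu_1,x,x)$ and $Z=(2,r,m,l_2,0,1,1,0,1,1)$: if $g=f_{123}$: Bob $(2,r,m,0,h,h_2+1,h_3+1,\mu_1,\mu_2,\mu_2)$; Henry with $\theta_1$ $Z$, reward $(h_1-\mu_1,0,\mu_1)$, with $\theta_2$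 $Y(\mu_2+1)$, with $1-\theta_1-\theta_2$ $Y(\mu_3+1)$. If $g=f_{13}$: Bob with $\gamma_1$ $(2,r,m,l_2,0,1,1,0,0,0)$, reward $w_1$, with $1-\gamma_1$ $Y(\mu_3)$; Henry with $\gamma_1$ $Z$, reward $w_1$, with $1-\gamma_1$ $Y(\mu_3+1)$. If $g=f_{12}$: Bob $Y(\mu_2)$; Henry with $\beta_1$ $Z$, reward $w_1$, with $\beta_2$ $Y(\mu_3+1)$. Rewards not mentioned are $0$. - All other cases with $\Delta=0$, $h\le h_3$. If $f\in\{r,ir\}$: $[0]\ (loc,ir,m,l_2,h,h_2,h_3,\mu_1,\mu_2,\mu_3);\ (loc,ir,m+1,l_2,h,h_2,h_3,\mu_1,\mu_2,\mu_3);\ (loc,ir,m,l_2+1,h,h_2,h_3,\mu_1,\mu_2,\mu_3);\ (loc,ir,m,l_2,h,h_2+1,h_3+1,\mu_1,\mu_2+1,\mu_3+1)$. Otherwise idle: $(loc,f,m,l_2,h,h_2,h_3,\mu_1,\mu_2,\mu_3)$; Alice: the same with $m+1$; both with reward $0$; and, with $V_l(q,x)=(2,r,m,l,h,q+1,q+1,\mu_1,x,x)$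 and $Z_l=(2,r,m,l,0,1,1,0,1,1)$: if $f=f_{12}$: Bob $V_{l_2}(h_2,\mu_2)$; Henry with $\beta_1$ $Z_{l_2}$, reward $w_1$, with $\beta_2$ $(2,r,m,l_2,h,h_2+1,h_3+1,\mu_1,\mu_2+1,\mu_2+1)$. If $f=f_{13}$: Bob with $\gamma_1$ $(2,r,m,l_2,0,1,1,0,0,0)$, reward $w_1$, with $1-\gamma_1$ $V_{l_2}(h_3,\mu_3)$; Henry with $\gamma_1$ $Z_0$, reward $w_1$, with $1-\gamma_1$ $V_{l_2}(h_3,\mu_3+1)$. If $f=f_{23}$: Bob $V_0(h_2,\mu_2)$; Henry with $\gamma_2$ $V_0(h_2,\mu_2+1)$, with $1-\gamma_2$ $V_0(h_2,\mu_3+1)$. If $f=f_{123}$: Bob $V_0(h_2,\mu_2)$; Henry with $\theta_1$ $Z_0$, reward $w_1$, with $\theta_2$ $V_0(h_3,\mu_2+1)$, with $1-\theta_1-\theta_2$ $V_0(h_3,\mu_3+1)$. Rewards not mentioned are $0$. *Length limits.* If the tuple $c$ given by these rules is not in $\mathcal S$ (it exceeds $l_2\le N$ or $h_3\le H$), the mining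 round ends: the next state is $s_0$, and a reward $\kappa(c)\in\mathbb R^3$ is added, where $\kappa$ is an arbitrary fixed function. *Beliefs and rewards.* $r(s,a)=(r_1,r_2,r_h)(s,a)$ is the expected reward of a slot in state $s$ under action $a$. A belief $b$ is a probability distribution on $\mathcal S$ whose support consists of states with one common observation. Put $w_\rho(b,a)=(1-\rho)r_1(b,a)-\rho\,(r_2(b,a)+r_h(b,a))$ with $r_k(b,a)=\sum_s b(s)r_k(s,a)$. After action $a$, observation $o$ has probability $\Pr(o\mid a,b)=\sum_{s':\,o(s')=o}\sum_s\Pr(s'\mid s,a)b(s)$, and the belief becomes $b'(s')=\mathbf 1_{o(s')=o}\sum_s\Pr(s'\mid s,a)b(s)/\Pr(o\mid a,b)$. For an initial belief $b$ and an admissible policy $\pi$ (history-dependent, possibly randomized, using only available actions), with beliefs $b_1=b,b_2,\dots$ and actions $a_1,a_2,\dots$, let $$v_\rho^\pi(b)=\mathbb E\Big[\liminf_{\xi\to\infty}\frac1\xi\sum_{i=1}^{\xi}w_\rho(b_i,a_i)\Big].$$ **Lemma.** There is an optimal stationary deterministic policy: a map $\varphi$ from beliefs to available actions such that, for every initial belief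 $b$ and every admissible policy $\pi$, $v_\rho^{\pi}(b)\le v_\rho^{\varphi}(b)$. -/

import Mathlib

open MeasureTheory ProbabilityTheory

noncomputable section

namespace SelfishMining

/-! ### States, actions, observations -/

/-- The branch Henry works on: `one` is the public chain with Alice's blocks, `two` the public
chain with Bob's blocks, `three` the public chain that has only Henry's blocks. -/
inductive Loc
  | one | two | three
  deriving DecidableEq

instance : Fintype Loc := ⟨{.one, .two, .three}, fun x => by cases x <;> simp⟩

/-- The attribute `fork`. -/
inductive Fork
  | ir | r | f12 | f13 | f23 | f123
  deriving DecidableEq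

instance : Fintype Fork := ⟨{.ir, .r, .f12, .f13, .f23, .f123}, fun x => by cases x <;> simp⟩

/-- The 10-tuple `⟨loc, fork, l₁, l₂, h₁, h₂, h₃, μ₁, μ₂, μ₃⟩`, without any bound on lengths. -/
structure Config where
  loc : Loc
  fork : Fork
  l1 : ℕ
  l2 : ℕ
  h1 : ℕ
  h2 : ℕ
  h3 : ℕ
  u1 : ℕ
  u2 : ℕ
  u3 : ℕ
  deriving DecidableEq

/-- Alice's actions: `adopt`, or `publish k` which releases `k` private blocks
(`publish 0` is waiting). -/
inductive Action
  | adopt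
  | publish (k : ℕ)
  deriving DecidableEq

/-- What Alice observes of a state: `⟨fork, l₁, h₁, h₃, μ₁⟩`. -/
structure Obs where
  fork : Fork
  l1 : ℕ
  h1 : ℕ
  h3 : ℕ
  u1 : ℕ
  deriving DecidableEq

def Config.observe (s : Config) : Obs := ⟨s.fork, s.l1, s.h1, s.h3, s.u1⟩

/-- The parameters of the model. -/
structure Params where
  /-- maximal length of a private chain -/
  N : ℕ
  /-- maximal length of the public chain -/
  H : ℕ
  /-- Hash power of Alice, Bob, Henry -/
  α1 : ℝ
  α2 : ℝ
  αh : ℝ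
  /-- probability that a block is mined in a time slot -/
  p : ℝ
  /-- tie-breaking parameters -/
  γ1 : ℝ
  γ2 : ℝ
  θ1 : ℝ
  θ2 : ℝ
  /-- The rewards of (Alice, Bob, Henry) that are credited, in addition to those of the transition,
  when a transition would lead to a configuration that exceeds a length limit and the mining round
  is therefore ended. Any choice is allowed. -/
  cutReward : Config → ℝ × ℝ × ℝ
  N_pos : 1 ≤ N
  H_pos : 1 ≤ H
  α1_pos : 0 < α1
  α2_pos : 0 < α2
  αh_pos : 0 < αh
  α_sum : α1 + α2 + αh = 1
  p_pos : 0 < p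
  p_le : p ≤ 1
  γ1_nonneg : 0 ≤ γ1
  γ1_le : γ1 ≤ 1
  γ2_nonneg : 0 ≤ γ2
  γ2_le : γ2 ≤ 1
  γ_pos : 0 < γ1 + γ2
  θ1_nonneg : 0 ≤ θ1
  θ2_nonneg : 0 ≤ θ2
  θ_le : θ1 + θ2 ≤ 1

/-- Tie-breaking between Alice and Bob. -/
def Params.β1 (P : Params) : ℝ := P.γ1 / (P.γ1 + P.γ2)
def Params.β2 (P : Params) : ℝ := P.γ2 / (P.γ1 + P.γ2)

/-- The state space: private chains have at most `N` unreleased blocks, the public chain has length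
at most `H`; starting positions lie on the public chain; Bob's whole chain `l₂ + h₂` is never behind
the public chain, and Bob hides blocks only while it is strictly ahead; `μᵢ` counts some of the `hᵢ`
blocks. -/
def IsState (P : Params) (s : Config) : Prop :=
  s.l1 ≤ P.N ∧ s.l2 ≤ P.N ∧ s.h3 ≤ P.H ∧ s.h1 ≤ s.h3 ∧ s.h2 ≤ s.h3 ∧ s.h3 ≤ s.l2 + s.h2 ∧
    (s.l2 + s.h2 = s.h3 → s.l2 = 0) ∧ s.u1 ≤ s.h1 ∧ s.u2 ≤ s.h2 ∧ s.u3 ≤ s.h3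

instance (P : Params) (s : Config) : Decidable (IsState P s) := by
  unfold IsState; infer_instance

abbrev State (P : Params) : Type := {s : Config // IsState P s}

instance (P : Params) : Finite (State P) := by
  let f : State P → Loc × Fork × Fin (P.N + 1) × Fin (P.N + 1) × Fin (P.H + 1) × Fin (P.H + 1) ×
      Fin (P.H + 1) × Fin (P.H + 1) × Fin (P.H + 1) × Fin (P.H + 1) := fun s =>
    (s.1.loc, s.1.fork, ⟨s.1.l1, by have := s.2; unfold IsState at this; omega⟩,
      ⟨s.1.l2, by have := s.2; unfold IsState at this; omega⟩,
      ⟨s.1.h1, by have := s.2; unfold IsState at this; omega⟩,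
      ⟨s.1.h2, by have := s.2; unfold IsState at this; omega⟩,
      ⟨s.1.h3, by have := s.2; unfold IsState at this; omega⟩,
      ⟨s.1.u1, by have := s.2; unfold IsState at this; omega⟩,
      ⟨s.1.u2, by have := s.2; unfold IsState at this; omega⟩,
      ⟨s.1.u3, by have := s.2; unfold IsState at this; omega⟩)
  apply Finite.of_injective f
  rintro ⟨⟨⟩, _⟩ ⟨⟨⟩, _⟩ h
  simp only [f, Prod.mk.injEq, Fin.mk.injEq] at h
  simpa using h

instance (P : Params) : Fintype (State P) := Fintype.ofFinite _

/-- The state in which all miners start on the same public chain and hide nothing. -/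
def startState (P : Params) : State P :=
  ⟨⟨.three, .ir, 0, 0, 0, 0, 0, 0, 0, 0⟩, by simp [IsState]⟩

/-- The configuration itself if it respects the length limits, otherwise the start of a new round. -/
def land (P : Params) (c : Config) : State P :=
  if h : IsState P c then ⟨c, h⟩ else startState P

/-- The actions that are available under an observation. If `l₁` reaches `N`, Alice has to release
at least one block or to adopt; if `h₃` reaches its maximum, she has to adopt or to release at least
`h₃ - h₁` blocks. -/
def Available (P : Params) (o : Obs) : Action → Prop
  | .adopt => True
  | .publish k => k ≤ o.l1 ∧ (o.l1 = P.N → 1 ≤ k) ∧ (o.h3 = P.H → o.h3 ≤ o.h1 + k)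

/-! ### Transitions and rewards -/

/-- One row of the transition table: probability, target, and the rewards of Alice, Bob, Henry. -/
structure Branch where
  prob : ℝ
  next : Config
  reward : ℝ × ℝ × ℝ

/-- A time slot with a common reward: no block is mined, or Alice, Bob, Henry mines one. -/
def slot (P : Params) (w : ℝ × ℝ × ℝ) (idle alice bob henry : Config) : List Branch :=
  [⟨1 - P.p, idle, w⟩, ⟨P.α1 * P.p, alice, w⟩, ⟨P.α2 * P.p, bob, w⟩, ⟨P.αh * P.p, henry, w⟩]

/-- Transitions under `adopt`. -/
def adoptRows (P : Params) : Config → List Branch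
  | ⟨loc, fork, _, l2, _, h2, h3, _, u2, u3⟩ =>
    if h3 + 2 < l2 + h2 then
      if loc ≠ .two then
        slot P (0, 0, 0)
          ⟨loc, .ir, 0, l2, h3, h2, h3, u3, u2, u3⟩
          ⟨.one, .ir, 1, l2, h3, h2, h3, u3, u2, u3⟩
          ⟨.one, .ir, 0, l2 + 1, h3, h2, h3, u3, u2, u3⟩
          ⟨.one, .r, 0, l2, h3, h2, h3 + 1, u3, u2, u3 + 1⟩
      else
        slot P (0, (h2 : ℝ) - u2, u2)
          ⟨.three, .ir, 0, l2, h3 - h2, 0, h3 - h2, h3 - h2, 0, h3 - h2⟩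
          ⟨.one, .ir, 1, l2, h3 - h2, 0, h3 - h2, h3 - h2, 0, h3 - h2⟩
          ⟨.one, .ir, 0, l2 + 1, h3 - h2, 0, h3 - h2, h3 - h2, 0, h3 - h2⟩
          ⟨.one, .r, 0, l2, h3 - h2, 0, h3 - h2 + 1, h3 - h2, 0, h3 - h2 + 1⟩
    else if l2 + h2 = h3 + 2 then
      if loc ≠ .two then
        slot P (0, 0, 0)
          ⟨loc, .ir, 0, l2, h3, h2, h3, u3, u2, u3⟩
          ⟨.one, .ir, 1, l2, h3, h2, h3, u3, u2, u3⟩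
          ⟨.one, .ir, 0, l2 + 1, h3, h2, h3, u3, u2, u3⟩
          ⟨.two, .r, 0, 0, h3, h2 + l2, h2 + l2, u3, u2, u2⟩
      else
        slot P (0, (h2 : ℝ) - u2, u2)
          ⟨.three, .ir, 0, l2, h3 - h2, 0, h3 - h2, h3 - h2, 0, h3 - h2⟩
          ⟨.one, .ir, 1, l2, h3 - h2, 0, h3 - h2, h3 - h2, 0, h3 - h2⟩
          ⟨.one, .ir, 0, l2 + 1, h3 - h2, 0, h3 - h2, h3 - h2, 0, h3 - h2⟩
          ⟨.two, .r, 0, 0, h3 - h2, l2, l2, h3 - h2, 0, 0⟩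
    else if l2 + h2 = h3 + 1 then
      slot P (0, (h2 : ℝ) - u2, u2)
        ⟨.one, .ir, 0, l2, h3 - h2, 0, h3 - h2, h3 - h2, 0, h3 - h2⟩
        ⟨.one, .ir, 1, l2, h3 - h2, 0, h3 - h2, h3 - h2, 0, h3 - h2⟩
        ⟨.one, .ir, 0, l2 + 1, h3 - h2, 0, h3 - h2, h3 - h2, 0, h3 - h2⟩
        ⟨loc, .f23, 0, 0, h3 - h2, h3 - h2 + 1, h3 - h2 + 1, 0, 0, 1⟩
    else if fork = .f23 ∨ fork = .f123 then
      if loc = .two then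
        [⟨1 - P.p, ⟨loc, .f23, 0, l2, 0, u3 - u2, u3 - u2, 0, 0, u3 - u2⟩, (0, (h3 : ℝ) - u3, u2)⟩,
         ⟨P.α1 * P.p * P.γ2, ⟨.one, .ir, 0, 0, 0, 0, 0, 0, 0, 0⟩, (1, (h2 : ℝ) - u2, u2)⟩,
         ⟨P.α1 * P.p * (1 - P.γ2), ⟨.three, .ir, 0, 0, 0, 0, 0, 0, 0, 0⟩, (1, (h3 : ℝ) - u3, u3)⟩,
         ⟨P.α2 * P.p, ⟨.two, .ir, 0, 0, 0, 0, 0, 0, 0, 0⟩, (0, (h2 : ℝ) + 1 - u2, u2)⟩,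
         ⟨P.αh * P.p * P.γ2, ⟨.two, .r, 0, 0, 0, 0, 0, 0, 0, 0⟩, (0, (h2 : ℝ) - u2, u2 + 1)⟩,
         ⟨P.αh * P.p * (1 - P.γ2), ⟨.three, .r, 0, 0, 0, 0, 0, 0, 0, 0⟩,
           (0, (h3 : ℝ) - u3, u3 + 1)⟩]
      else
        [⟨1 - P.p, ⟨loc, .f23, 0, l2, h3, h2, h3, u3, u2, u3⟩, (0, 0, 0)⟩,
         ⟨P.α1 * P.p * P.γ2, ⟨.one, .ir, 0, 0, 0, 0, 0, 0, 0, 0⟩, (1, (h2 : ℝ) - u2, u2)⟩,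
         ⟨P.α1 * P.p * (1 - P.γ2), ⟨.three, .ir, 0, 0, 0, 0, 0, 0, 0, 0⟩,
           (1 + (h3 : ℝ) - u3, 0, u3)⟩,
         ⟨P.α2 * P.p, ⟨.two, .ir, 0, 0, 0, 0, 0, 0, 0, 0⟩, (0, (h2 : ℝ) + 1 - u2, u2)⟩,
         ⟨P.αh * P.p * P.γ2, ⟨.two, .r, 0, 0, 0, 0, 0, 0, 0, 0⟩, (0, (h2 : ℝ) - u2, u2 + 1)⟩,
         ⟨P.αh * P.p * (1 - P.γ2), ⟨.three, .r, 0, 0, 0, 0, 0, 0, 0, 0⟩,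
           ((h3 : ℝ) - u3, 0, u3 + 1)⟩]
    else if fork = .f12 ∨ (fork ≠ .f13 ∧ loc = .two) then
      slot P (0, (h2 : ℝ) - u2, u2)
        ⟨.three, .ir, 0, 0, 0, 0, 0, 0, 0, 0⟩
        ⟨.three, .ir, 1, 0, 0, 0, 0, 0, 0, 0⟩
        ⟨.three, .ir, 0, 1, 0, 0, 0, 0, 0, 0⟩
        ⟨.three, .r, 0, 0, 0, 1, 1, 0, 1, 1⟩
    else
      slot P ((h3 : ℝ) - u3, 0, u3)
        ⟨.three, .ir, 0, 0, 0, 0, 0, 0, 0, 0⟩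
        ⟨.three, .ir, 1, 0, 0, 0, 0, 0, 0, 0⟩
        ⟨.three, .ir, 0, 1, 0, 0, 0, 0, 0, 0⟩
        ⟨.three, .r, 0, 0, 0, 1, 1, 0, 1, 1⟩

/-- Alice's released chain becomes strictly longer than Bob's whole chain. -/
def overrideRows (P : Params) (a : ℕ) : Config → List Branch
  | ⟨_, _, l1, _, h1, _, _, u1, _, _⟩ =>
    slot P ((h1 : ℝ) + a - u1, 0, u1)
      ⟨.three, .ir, l1 - a, 0, 0, 0, 0, 0, 0, 0⟩
      ⟨.three, .ir, l1 - a + 1, 0, 0, 0, 0, 0, 0, 0⟩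
      ⟨.three, .ir, l1 - a, 1, 0, 0, 0, 0, 0, 0⟩
      ⟨.three, .r, l1 - a, 0, 0, 1, 1, 0, 1, 1⟩

/-- Alice's released chain becomes as long as Bob's whole chain, which is ahead of the public
chain; Bob releases. -/
def matchBobRows (P : Params) (a : ℕ) : Config → List Branch
  | ⟨loc, _, l1, l2, h1, h2, _, u1, u2, u3⟩ =>
    [⟨1 - P.p, ⟨loc, .f12, l1 - a, 0, h1 + a, h2 + l2, h2 + l2, u1, u2, u3⟩, (0, 0, 0)⟩,
     ⟨P.α1 * P.p, ⟨loc, .f12, l1 - a + 1, 0, h1 + a, h2 + l2, h2 + l2, u1, u2, u3⟩, (0, 0, 0)⟩,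
     ⟨P.α2 * P.p, ⟨.two, .r, l1 - a, 0, h1 + a, h2 + l2 + 1, h2 + l2 + 1, u1, u2, u2⟩, (0, 0, 0)⟩,
     ⟨P.αh * P.p * P.β2,
       ⟨.two, .r, l1 - a, 0, h1 + a, h2 + l2 + 1, h2 + l2 + 1, u1, u2 + 1, u2 + 1⟩, (0, 0, 0)⟩,
     ⟨P.αh * P.p * P.β1, ⟨.two, .r, l1 - a, 0, 0, 1, 1, 0, 1, 1⟩, ((h1 : ℝ) + a - u1, 0, u1)⟩]

/-- Alice's released chain ends one block behind Bob's whole chain, which is at least two blocks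
ahead of the public chain; Bob releases. -/
def oneBehindRows (P : Params) (a : ℕ) : Config → List Branch
  | ⟨_, _, l1, l2, h1, h2, _, u1, u2, _⟩ =>
    slot P (0, 0, 0)
      ⟨.two, .ir, l1 - a, 0, h1 + a, h2 + l2, h2 + l2, u1, u2, u2⟩
      ⟨.two, .r, l1 + 1 - a, 0, h1 + a, h2 + l2, h2 + l2, u1, u2, u2⟩
      ⟨.two, .r, l1 - a, 1, h1 + a, h2 + l2, h2 + l2, u1, u2, u2⟩
      ⟨.two, .r, l1 - a, 0, h1 + a, h2 + l2 + 1, h2 + l2 + 1, u1, u2 + 1, u2 + 1⟩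

/-- Alice publishes `a` blocks while Bob's chain is level with the public chain and she neither
overrides nor newly enters a tie. For `a = 0` this is waiting; the published blocks move from `l₁`
to `h₁`. -/
def levelRows (P : Params) (a : ℕ) : Config → List Branch
  | ⟨loc, fork, l1, l2, h1, h2, h3, u1, u2, u3⟩ =>
    match fork with
    | .f12 =>
      [⟨1 - P.p, ⟨loc, fork, l1 - a, l2, h1 + a, h2, h3, u1, u2, u3⟩, (0, 0, 0)⟩,
       ⟨P.α1 * P.p, ⟨loc, fork, l1 - a + 1, l2, h1 + a, h2, h3, u1, u2, u3⟩, (0, 0, 0)⟩,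
       ⟨P.α2 * P.p, ⟨.two, .r, l1 - a, l2, h1 + a, h2 + 1, h2 + 1, u1, u2, u2⟩, (0, 0, 0)⟩,
       ⟨P.αh * P.p * P.β1, ⟨.two, .r, l1 - a, l2, 0, 1, 1, 0, 1, 1⟩, ((h1 : ℝ) + a - u1, 0, u1)⟩,
       ⟨P.αh * P.p * P.β2, ⟨.two, .r, l1 - a, l2, h1 + a, h2 + 1, h3 + 1, u1, u2 + 1, u2 + 1⟩,
         (0, 0, 0)⟩]
    | .f13 =>
      [⟨1 - P.p, ⟨loc, fork, l1 - a, l2, h1 + a, h2, h3, u1, u2, u3⟩, (0, 0, 0)⟩,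
       ⟨P.α1 * P.p, ⟨loc, fork, l1 - a + 1, l2, h1 + a, h2, h3, u1, u2, u3⟩, (0, 0, 0)⟩,
       ⟨P.α2 * P.p * P.γ1, ⟨.two, .r, l1 - a, l2, 0, 1, 1, 0, 0, 0⟩, ((h1 : ℝ) + a - u1, 0, u1)⟩,
       ⟨P.α2 * P.p * (1 - P.γ1), ⟨.two, .r, l1 - a, l2, h1 + a, h3 + 1, h3 + 1, u1, u3, u3⟩,
         (0, 0, 0)⟩,
       ⟨P.αh * P.p * P.γ1, ⟨.two, .r, l1 - a, 0, 0, 1, 1, 0, 1, 1⟩, ((h1 : ℝ) + a - u1, 0, u1)⟩,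
       ⟨P.αh * P.p * (1 - P.γ1),
         ⟨.two, .r, l1 - a, l2, h1 + a, h3 + 1, h3 + 1, u1, u3 + 1, u3 + 1⟩, (0, 0, 0)⟩]
    | .f23 =>
      [⟨1 - P.p, ⟨loc, fork, l1 - a, l2, h1 + a, h2, h3, u1, u2, u3⟩, (0, 0, 0)⟩,
       ⟨P.α1 * P.p, ⟨loc, fork, l1 - a + 1, l2, h1 + a, h2, h3, u1, u2, u3⟩, (0, 0, 0)⟩,
       ⟨P.α2 * P.p, ⟨.two, .r, l1 - a, 0, h1 + a, h2 + 1, h2 + 1, u1, u2, u2⟩, (0, 0, 0)⟩,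
       ⟨P.αh * P.p * P.γ2, ⟨.two, .r, l1 - a, 0, h1 + a, h2 + 1, h2 + 1, u1, u2 + 1, u2 + 1⟩,
         (0, 0, 0)⟩,
       ⟨P.αh * P.p * (1 - P.γ2),
         ⟨.two, .r, l1 - a, 0, h1 + a, h2 + 1, h2 + 1, u1, u3 + 1, u3 + 1⟩, (0, 0, 0)⟩]
    | .f123 =>
      [⟨1 - P.p, ⟨loc, fork, l1 - a, l2, h1 + a, h2, h3, u1, u2, u3⟩, (0, 0, 0)⟩,
       ⟨P.α1 * P.p, ⟨loc, fork, l1 - a + 1, l2, h1 + a, h2, h3, u1, u2, u3⟩, (0, 0, 0)⟩,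
       ⟨P.α2 * P.p, ⟨.two, .r, l1 - a, 0, h1 + a, h2 + 1, h2 + 1, u1, u2, u2⟩, (0, 0, 0)⟩,
       ⟨P.αh * P.p * P.θ1, ⟨.two, .r, l1 - a, 0, 0, 1, 1, 0, 1, 1⟩, ((h1 : ℝ) + a - u1, 0, u1)⟩,
       ⟨P.αh * P.p * P.θ2, ⟨.two, .r, l1 - a, 0, h1 + a, h3 + 1, h3 + 1, u1, u2 + 1, u2 + 1⟩,
         (0, 0, 0)⟩,
       ⟨P.αh * P.p * (1 - P.θ1 - P.θ2),
         ⟨.two, .r, l1 - a, 0, h1 + a, h3 + 1, h3 + 1, u1, u3 + 1, u3 + 1⟩, (0, 0, 0)⟩]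
    | .r | .ir =>
      slot P (0, 0, 0)
        ⟨loc, .ir, l1 - a, l2, h1 + a, h2, h3, u1, u2, u3⟩
        ⟨loc, .ir, l1 - a + 1, l2, h1 + a, h2, h3, u1, u2, u3⟩
        ⟨loc, .ir, l1 - a, l2 + 1, h1 + a, h2, h3, u1, u2, u3⟩
        ⟨loc, .ir, l1 - a, l2, h1 + a, h2 + 1, h3 + 1, u1, u2 + 1, u3 + 1⟩

/-- Alice publishes `a > 0` blocks and thereby enters a tie with the public chain, with which
Bob's chain is level. -/
def tieRows (P : Params) (a : ℕ) : Config → List Branch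
  | ⟨loc, fork, l1, l2, h1, h2, h3, u1, u2, u3⟩ =>
    if fork = .f23 then
      [⟨1 - P.p, ⟨loc, .f123, l1 - a, l2, h1 + a, h2, h3, u1, u2, u3⟩, (0, 0, 0)⟩,
       ⟨P.α1 * P.p, ⟨loc, .f123, l1 - a + 1, l2, h1 + a, h2, h3, u1, u2, u3⟩, (0, 0, 0)⟩,
       ⟨P.α2 * P.p, ⟨.two, .r, l1 - a, 0, h1 + a, h2 + 1, h3 + 1, u1, u2, u2⟩, (0, 0, 0)⟩,
       ⟨P.αh * P.p * P.θ1, ⟨.two, .r, l1 - a, l2, 0, 1, 1, 0, 1, 1⟩, ((h1 : ℝ) - u1, 0, u1)⟩,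
       ⟨P.αh * P.p * P.θ2, ⟨.two, .r, l1 - a, l2, h1 + a, h2 + 1, h3 + 1, u1, u2 + 1, u2 + 1⟩,
         (0, 0, 0)⟩,
       ⟨P.αh * P.p * (1 - P.θ1 - P.θ2),
         ⟨.two, .r, l1 - a, l2, h1 + a, h2 + 1, h3 + 1, u1, u3 + 1, u3 + 1⟩, (0, 0, 0)⟩]
    else if h2 = u2 then
      [⟨1 - P.p, ⟨loc, .f13, l1 - a, l2, h1 + a, h2, h3, u1, u2, u3⟩, (0, 0, 0)⟩,
       ⟨P.α1 * P.p, ⟨loc, .f13, l1 - a + 1, l2, h1 + a, h2, h3, u1, u2, u3⟩, (0, 0, 0)⟩,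
       ⟨P.α2 * P.p * P.γ1, ⟨.two, .r, l1 - a, l2, 0, 1, 1, 0, 0, 0⟩, ((h1 : ℝ) + a - u1, 0, u1)⟩,
       ⟨P.α2 * P.p * (1 - P.γ1), ⟨.two, .r, l1 - a, l2, h1 + a, h2 + 1, h3 + 1, u1, u3, u3⟩,
         (0, 0, 0)⟩,
       ⟨P.αh * P.p * P.γ1, ⟨.two, .r, l1 - a, l2, 0, 1, 1, 0, 1, 1⟩, ((h1 : ℝ) + a - u1, 0, u1)⟩,
       ⟨P.αh * P.p * (1 - P.γ1),
         ⟨.two, .r, l1 - a, l2, h1 + a, h2 + 1, h3 + 1, u1, u3 + 1, u3 + 1⟩, (0, 0, 0)⟩]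
    else
      [⟨1 - P.p, ⟨loc, .f12, l1 - a, l2, h1 + a, h2, h3, u1, u2, u3⟩, (0, 0, 0)⟩,
       ⟨P.α1 * P.p, ⟨loc, .f12, l1 - a + 1, l2, h1 + a, h2, h3, u1, u2, u3⟩, (0, 0, 0)⟩,
       ⟨P.α2 * P.p, ⟨.two, .r, l1 - a, l2, h1 + a, h2 + 1, h3 + 1, u1, u2, u2⟩, (0, 0, 0)⟩,
       ⟨P.αh * P.p * P.β1, ⟨.two, .r, l1 - a, l2, 0, 1, 1, 0, 1, 1⟩, ((h1 : ℝ) + a - u1, 0, u1)⟩,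
       ⟨P.αh * P.p * P.β2,
         ⟨.two, .r, l1 - a, l2, h1 + a, h2 + 1, h3 + 1, u1, u3 + 1, u3 + 1⟩, (0, 0, 0)⟩]

/-- Alice's chain, after she publishes `a` blocks, is at most as long as the public chain, and Bob's
chain is ahead of the public chain. -/
def behindRows (P : Params) (a : ℕ) : Config → List Branch
  | ⟨loc, fork, l1, l2, h1, h2, h3, u1, u2, u3⟩ =>
    if l2 + h2 = h3 + 1 then
      slot P (0, 0, 0)
        ⟨loc, .ir, l1 - a, l2, h1 + a, h2, h3, u1, u2, u3⟩
        ⟨loc, .ir, l1 - a + 1, l2, h1 + a, h2, h3, u1, u2, u3⟩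
        ⟨loc, .ir, l1 - a, l2 + 1, h1 + a, h2, h3, u1, u2, u3⟩
        ⟨loc, .f23, l1 - a, 0, h1 + a, h3 + 1, h3 + 1, u1, u2, u3 + 1⟩
    else if h1 + a = h3 ∧ ((fork = .r ∧ 0 < a) ∨ (fork = .f13 ∧ a = 0)) then
      if l2 + h2 = h3 + 2 then
        slot P (0, 0, 0)
          ⟨loc, .f13, l1 - a, l2, h3, h2, h3, u1, u2, u3⟩
          ⟨loc, .f13, l1 - a + 1, l2, h3, h2, h3, u1, u2, u3⟩
          ⟨loc, .f13, l1 - a, l2 + 1, h3, h2, h3, u1, u2, u3⟩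
          ⟨.two, .r, l1 - a, 0, h1 + a, h2 + l2, h2 + l2, u1, u2, u2⟩
      else
        [⟨1 - P.p, ⟨loc, .f13, l1 - a, l2, h3, h2, h3, u1, u2, u3⟩, (0, 0, 0)⟩,
         ⟨P.α1 * P.p, ⟨loc, .f13, l1 - a + 1, l2, h3, h2, h3, u1, u2, u3⟩, (0, 0, 0)⟩,
         ⟨P.α2 * P.p, ⟨loc, .f13, l1 - a, l2 + 1, h3, h2, h3, u1, u2, u3⟩, (0, 0, 0)⟩,
         ⟨P.αh * P.p * P.γ1, ⟨.one, .r, l1 - a, l2, h3, h2, h3 + 1, u1, u2, u1 + 1⟩, (0, 0, 0)⟩,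
         ⟨P.αh * P.p * (1 - P.γ1), ⟨loc, .r, l1 - a, l2, h3, h2, h3 + 1, u1, u2, u3 + 1⟩,
           (0, 0, 0)⟩]
    else
      slot P (0, 0, 0)
        ⟨loc, .ir, l1 - a, l2, h1 + a, h2, h3, u1, u2, u3⟩
        ⟨loc, .ir, l1 - a + 1, l2, h1 + a, h2, h3, u1, u2, u3⟩
        ⟨loc, .ir, l1 - a, l2 + 1, h1 + a, h2, h3, u1, u2, u3⟩
        (if l2 + h2 = h3 + 2 then
          ⟨.two, .r, l1 - a, 0, h1 + a, h2 + l2, h2 + l2, u1, u2, u2⟩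
        else ⟨loc, .r, l1 - a, l2, h1 + a, h2, h3 + 1, u1, u2, u3 + 1⟩)

/-- Alice's chain, after she publishes `a` blocks, is longer than the public chain, but more than
one block behind Bob's whole chain. -/
def leadRows (P : Params) (a : ℕ) : Config → List Branch
  | ⟨_, _, l1, l2, h1, h2, _, u1, u2, _⟩ =>
    slot P (0, 0, 0)
      ⟨.one, .ir, l1 - a, l2, h1 + a, h2, h1 + a, u1, u2, u1⟩
      ⟨.one, .ir, l1 - a + 1, l2, h1 + a, h2, h1 + a, u1, u2, u1⟩
      ⟨.one, .ir, l1 - a, l2 + 1, h1 + a, h2, h1 + a, u1, u2, u1⟩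
      ⟨.one, .r, l1 - a, l2, h1 + a, h2, h1 + a + 1, u1, u2, u1 + 1⟩

/-- The transition table. -/
def rows (P : Params) (s : Config) : Action → List Branch
  | .adopt => adoptRows P s
  | .publish a =>
    if s.l2 + s.h2 < s.h1 + a then overrideRows P a s
    else if s.l2 + s.h2 = s.h3 then
      if 0 < a ∧ s.h1 + a = s.h3 ∧ (s.fork = .f23 ∨ s.fork = .r) then tieRows P a s
      else levelRows P a s
    else if s.h1 + a ≤ s.h3 then behindRows P a s
    else if s.h1 + a = s.l2 + s.h2 then matchBobRows P a s
    else if s.h1 + a + 1 = s.l2 + s.h2 then oneBehindRows P a s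
    else leadRows P a s

/-- The transition probability `Pr(s' | s, a)`. -/
def trans (P : Params) (s : State P) (a : Action) (s' : State P) : ℝ :=
  ((rows P s a).map fun br => if land P br.next = s' then br.prob else 0).sum

/-- The expected rewards `(r₁, r₂, r_h)` of a time slot in which Alice takes action `a` at `s`. -/
def reward (P : Params) (s : State P) (a : Action) : ℝ × ℝ × ℝ :=
  ((rows P s a).map fun br =>
    br.prob • (br.reward + if IsState P br.next then 0 else P.cutReward br.next)).sum

/-- `w_ρ(r₁, r₂, r_h) = (1 - ρ) r₁ - ρ (r₂ + r_h)`. -/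
def weigh (ρ : ℝ) (r : ℝ × ℝ × ℝ) : ℝ := (1 - ρ) * r.1 - ρ * (r.2.1 + r.2.2)

/-- The observation function: the observation of a state is certain. -/
def obsFun (P : Params) (s : State P) (_a : Action) (o : Obs) : ℝ :=
  if s.1.observe = o then 1 else 0

/-! ### The transition table is a probability kernel -/

lemma β1_nonneg (P : Params) : 0 ≤ P.β1 := div_nonneg P.γ1_nonneg P.γ_pos.le
lemma β2_nonneg (P : Params) : 0 ≤ P.β2 := div_nonneg P.γ2_nonneg P.γ_pos.le
lemma β_sum (P : Params) : P.β1 + P.β2 = 1 := by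
  have := P.γ_pos.ne'
  unfold Params.β1 Params.β2
  field_simp

lemma rows_nonneg (P : Params) (s : Config) (a : Action) : ∀ br ∈ rows P s a, 0 ≤ br.prob := by
  have hp := sub_nonneg.2 P.p_le
  have h1 := mul_nonneg P.α1_pos.le P.p_pos.le
  have h2 := mul_nonneg P.α2_pos.le P.p_pos.le
  have h3 := mul_nonneg P.αh_pos.le P.p_pos.le
  have g1 := P.γ1_nonneg
  have g1' := sub_nonneg.2 P.γ1_le
  have g2 := P.γ2_nonneg
  have g2' := sub_nonneg.2 P.γ2_le
  have b1 := β1_nonneg P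
  have b2 := β2_nonneg P
  have t1 := P.θ1_nonneg
  have t2 := P.θ2_nonneg
  have t3 : 0 ≤ 1 - P.θ1 - P.θ2 := by linarith [P.θ_le]
  obtain ⟨loc, fork, l1, l2, k1, k2, k3, u1, u2, u3⟩ := s
  cases a with
  | adopt =>
    simp only [rows, adoptRows, slot]
    split_ifs <;>
      simp only [List.mem_cons, List.not_mem_nil, or_false, forall_eq_or_imp, forall_eq] <;>
      (refine ⟨?_, ?_, ?_, ?_⟩ <;> first | positivity | (refine ⟨?_, ?_, ?_⟩ <;> positivity))
  | publish a =>
    simp only [rows]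
    split_ifs <;>
      simp only [overrideRows, tieRows, levelRows, behindRows, matchBobRows, oneBehindRows,
        leadRows, slot] <;>
      (try split) <;> (try split_ifs) <;>
      simp only [List.mem_cons, List.not_mem_nil, or_false, forall_eq_or_imp, forall_eq] <;>
      (repeat' apply And.intro) <;> positivity

lemma rows_sum (P : Params) (s : Config) (a : Action) :
    ((rows P s a).map Branch.prob).sum = 1 := by
  have hα := P.α_sum
  have hβ := β_sum P
  have e : P.αh = 1 - P.α1 - P.α2 := by linarith
  have e' : P.β2 = 1 - P.β1 := by linarith
  obtain ⟨loc, fork, l1, l2, k1, k2, k3, u1, u2, u3⟩ := s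
  cases a with
  | adopt =>
    simp only [rows, adoptRows, slot]
    split_ifs <;> simp only [List.map_cons, List.map_nil, List.sum_cons, List.sum_nil, e] <;> ring
  | publish a =>
    simp only [rows]
    split_ifs <;>
      simp only [overrideRows, tieRows, levelRows, behindRows, matchBobRows, oneBehindRows,
        leadRows, slot] <;>
      (try split) <;> (try split_ifs) <;>
      simp only [List.map_cons, List.map_nil, List.sum_cons, List.sum_nil, e, e'] <;> ring

lemma trans_nonneg (P : Params) (s : State P) (a : Action) (s' : State P) :
    0 ≤ trans P s a s' := by
  apply List.sum_nonneg
  intro x hx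
  obtain ⟨br, hbr, rfl⟩ := List.mem_map.1 hx
  split_ifs
  · exact rows_nonneg P s a br hbr
  · exact le_rfl

lemma trans_sum (P : Params) (s : State P) (a : Action) : ∑ s', trans P s a s' = 1 := by
  rw [← rows_sum P s a]
  unfold trans
  generalize rows P s a = L
  induction L with
  | nil => simp
  | cons br L ih => simp [Finset.sum_add_distrib, ih]

/-! ### Beliefs -/

/-- A belief of Alice: a probability distribution over the states that have the observation she
currently makes. -/
structure Belief (P : Params) where
  mass : State P → ℝ
  obs : Obs
  nonneg : ∀ s, 0 ≤ mass s
  sum_one : ∑ s, mass s = 1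
  consistent : ∀ s, mass s ≠ 0 → s.1.observe = obs

variable {P : Params}

/-- `∑ₛ Pr(s' | a, s) b(s)`. -/
def Belief.predict (b : Belief P) (a : Action) (s' : State P) : ℝ :=
  ∑ s, trans P s a s' * b.mass s

/-- `Pr(o | a, b)`. -/
def Belief.obsProb (b : Belief P) (a : Action) (o : Obs) : ℝ :=
  ∑ s', obsFun P s' a o * b.predict a s'

lemma Belief.predict_nonneg (b : Belief P) (a : Action) (s' : State P) : 0 ≤ b.predict a s' :=
  Finset.sum_nonneg fun s _ => mul_nonneg (trans_nonneg P s a s') (b.nonneg s)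

lemma Belief.predict_sum (b : Belief P) (a : Action) : ∑ s', b.predict a s' = 1 := by
  unfold Belief.predict
  rw [Finset.sum_comm]
  simp [← Finset.sum_mul, trans_sum, b.sum_one]

lemma obsFun_nonneg (s : State P) (a : Action) (o : Obs) : 0 ≤ obsFun P s a o := by
  unfold obsFun; split_ifs <;> simp

/-- The updated belief after action `a` and observation `o` (if `o` has probability `0`, the belief
is left unchanged). -/
def Belief.update (b : Belief P) (a : Action) (o : Obs) : Belief P :=
  if h : 0 < b.obsProb a o then
    { mass := fun s' => obsFun P s' a o * b.predict a s' / b.obsProb a o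
      obs := o
      nonneg := fun s' =>
        div_nonneg (mul_nonneg (obsFun_nonneg s' a o) (b.predict_nonneg a s')) h.le
      sum_one := by
        rw [← Finset.sum_div]
        exact div_self h.ne'
      consistent := fun s' hs => by
        by_contra hne
        exact hs (by simp [obsFun, hne]) }
  else b

/-- The law of the next observation. -/
def Belief.obsLaw (b : Belief P) (a : Action) : PMF Obs :=
  (PMF.ofFintype (fun s' => ENNReal.ofReal (b.predict a s')) (by
    rw [← ENNReal.ofReal_sum_of_nonneg fun s' _ => b.predict_nonneg a s', b.predict_sum a,
      ENNReal.ofReal_one])).map fun s' => s'.1.observe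

/-- The law of the next observation gives `o` the probability `Pr(o | a, b)`. -/
lemma Belief.obsLaw_apply (b : Belief P) (a : Action) (o : Obs) :
    b.obsLaw a o = ENNReal.ofReal (b.obsProb a o) := by
  classical
  unfold Belief.obsLaw Belief.obsProb
  rw [PMF.map_apply, tsum_fintype, ENNReal.ofReal_sum_of_nonneg fun s' _ =>
    mul_nonneg (obsFun_nonneg s' a o) (b.predict_nonneg a s')]
  refine Finset.sum_congr rfl fun s' _ => ?_
  by_cases h : s'.1.observe = o
  · simp [obsFun, h]
  · simp [obsFun, h, Ne.symm h]

/-- The reward `w_ρ(r₁(b, a), r₂(b, a), r_h(b, a))`, where `r_k(b, a) = ∑ₛ b(s) r_k(s, a)`. -/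
def Belief.gain (ρ : ℝ) (b : Belief P) (a : Action) : ℝ :=
  weigh ρ (∑ s, b.mass s • reward P s a)

/-! ### Policies and their average rewards -/

/-- The action taken in a slot and the observation made after it. -/
abbrev Step : Type := Action × Obs

instance : MeasurableSpace Action := ⊤
instance : MeasurableSpace Obs := ⊤
instance : Countable Action :=
  Function.Injective.countable
    (f := fun a : Action => match a with | .adopt => (none : Option ℕ) | .publish k => some k)
    (by rintro (_ | _) (_ | _) h <;> simp_all)
instance : Countable Obs :=
  Function.Injective.countable
    (f := fun o : Obs => (Fintype.equivFin Fork o.fork, o.l1, o.h1, o.h3, o.u1))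
    (by rintro ⟨⟩ ⟨⟩ h; simp_all)

/-- The belief after a history, whose most recent step comes first. -/
def Belief.after (b : Belief P) : List Step → Belief P
  | [] => b
  | (a, o) :: h => (b.after h).update a o

/-- A history-dependent randomized policy. -/
abbrev Policy : Type := List Step → PMF Action

/-- A policy is admissible from the initial belief `b` if it takes available actions only. -/
def Policy.Admissible (P : Params) (b : Belief P) (π : Policy) : Prop :=
  ∀ h : List Step, ∀ a ∈ (π h).support, Available P (b.after h).obs a

/-- The policy that, started from `b`, takes the action `φ b'` whenever the current belief
is `b'`. -/
def stationary (b : Belief P) (φ : Belief P → Action) : Policy :=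
  fun h => PMF.pure (φ (b.after h))

/-- The law of the next step, given the history. -/
def stepLaw (b : Belief P) (π : Policy) (h : List Step) : PMF Step :=
  (π h).bind fun a => ((b.after h).obsLaw a).map fun o => (a, o)

/-- The history `[ω n, …, ω 1]` of a run `ω`; step `0` is a dummy. -/
def history (ω : ℕ → Step) (n : ℕ) : List Step := List.ofFn fun i : Fin n => ω (n - i)

/-- The Markov kernel from the first `n` steps to the next one. -/
def stepKernel (b : Belief P) (π : Policy) (n : ℕ) :
    Kernel (Π _ : Finset.Iic n, Step) Step :=
  Kernel.ofFunOfCountable fun x =>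
    (stepLaw b π (history (fun k => if hk : k ∈ Finset.Iic n then x ⟨k, hk⟩ else x ⟨0, by simp⟩)
      n)).toMeasure

instance (b : Belief P) (π : Policy) (n : ℕ) : IsMarkovKernel (stepKernel b π n) :=
  ⟨fun x => by
    change IsProbabilityMeasure (PMF.toMeasure _)
    infer_instance⟩

/-- The law of the run of the model from the initial belief `b` under the policy `π`. -/
def runLaw (b : Belief P) (π : Policy) : Measure (ℕ → Step) :=
  Kernel.traj (X := fun _ => Step) (stepKernel b π) 0 fun _ => (Action.adopt, b.obs)

/-- The expected average reward `v_ρ^π = 𝔼[liminf_{ξ → ∞} (1/ξ) ∑_{i < ξ} w_ρ(bᵢ, aᵢ)]`. -/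
def value (ρ : ℝ) (b : Belief P) (π : Policy) : ℝ :=
  ∫ ω, Filter.liminf (fun ξ : ℕ => (1 / (ξ : ℝ)) *
      ∑ i ∈ Finset.range ξ, (b.after (history ω i)).gain ρ (ω (i + 1)).1) Filter.atTop
    ∂(runLaw b π)

end SelfishMining

end

/-!
The model is a partially observed Markov decision process with finitely many states, observations
and available actions, and the policy is found by letting the discount vanish.

For a discount factor `l < 1` the optimality equation has a bounded solution `V`, the fixed point of
the Bellman contraction (`exists_isDiscountedValue`). What makes the limit `l → 1` possible is that
the oscillation of `V` is bounded uniformly in `l` (`exists_abs_sub_le`). This rests on one state,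
`aheadState`, in which Alice hides one block and nothing else has happened.

* Whatever Alice does, `aheadState` occurs within a bounded number of slots with a probability that
  is bounded below (`exists_rank_lt`). If Bob keeps mining, then Alice runs out of hidden blocks, ties
  get resolved, and Bob's lead grows until it exceeds the length limit and a new round starts; if Alice
  mines then, the state is `aheadState`. Moreover `V` is convex in the belief
  (`IsDiscountedValue.le_sum_dirac`), so where the true state may be `aheadState`, the value is at
  most a mixture of the value of knowing this and the supremum of `V`. Hence the supremum exceeds
  the value of the belief that is certain of `aheadState` by a bounded amount.
* Conversely Alice can adopt until the true state is `aheadState` and then release her block. If she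
  mines the next block, her observation is possible only after an override, so it reveals the state
  (`eq_aheadState_of_trans`). Hence the infimum of `V` is smaller by at most a bounded amount.

Relative values therefore converge along an ultrafilter, and as only finitely many actions are
available at a belief, their limit solves the average-reward optimality equation for some gain `g`,
with a maximizing action at every belief (`exists_isAverageSolution`). Neither continuity nor
measurability in the belief is needed.

Along a run, the rewards minus `g` are, up to a bounded telescoping term, the increments of a
martingale with bounded increments plus conditional expectations that are nonpositive for every
admissible policy and vanish for the maximizing one. The martingale is negligible almost surely
(`ae_tendsto_div_zero`, by fourth moments), so the lower limit of the average rewards is almost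
surely at most `g`, and equal to `g` for the maximizing policy.
-/

namespace SelfishMining

noncomputable section

variable {P : Params}

/-! ### Beliefs, predictions and expected continuations -/

lemma weigh_add (ρ : ℝ) (x y : ℝ × ℝ × ℝ) : weigh ρ (x + y) = weigh ρ x + weigh ρ y := by
  simp only [weigh, Prod.fst_add, Prod.snd_add]; ring

lemma weigh_smul (ρ c : ℝ) (x : ℝ × ℝ × ℝ) : weigh ρ (c • x) = c * weigh ρ x := by
  simp only [weigh, Prod.smul_fst, Prod.smul_snd, smul_eq_mul]; ring

lemma weigh_sum {ι : Type*} (ρ : ℝ) (S : Finset ι) (f : ι → ℝ × ℝ × ℝ) :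
    weigh ρ (∑ i ∈ S, f i) = ∑ i ∈ S, weigh ρ (f i) := by
  classical
  induction S using Finset.induction_on with
  | empty => simp [weigh]
  | insert i S hi ih => rw [Finset.sum_insert hi, Finset.sum_insert hi, weigh_add, ih]

lemma Belief.gain_eq (ρ : ℝ) (b : Belief P) (a : Action) :
    b.gain ρ a = ∑ s, b.mass s * weigh ρ (reward P s a) := by
  simp only [Belief.gain, weigh_sum, weigh_smul]

@[ext]
lemma Belief.ext_mass {b b' : Belief P} (hm : b.mass = b'.mass) (ho : b.obs = b'.obs) : b = b' := by
  cases b; cases b'; simp_all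

lemma Belief.exists_mass_pos (b : Belief P) : ∃ s, 0 < b.mass s := by
  by_contra! h
  have := b.sum_one
  rw [Finset.sum_eq_zero fun s _ => le_antisymm (h s) (b.nonneg s)] at this
  exact zero_ne_one this

lemma Belief.mass_le_one (b : Belief P) (s : State P) : b.mass s ≤ 1 := by
  rw [← b.sum_one]
  exact Finset.single_le_sum (fun s _ => b.nonneg s) (Finset.mem_univ s)

/-- Some state carries at least the average mass. -/
lemma Belief.exists_mass_ge (b : Belief P) : ∃ s, 1 / (Fintype.card (State P) : ℝ) ≤ b.mass s := by
  by_contra! h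
  have h1 : ∑ s, b.mass s < ∑ _s : State P, 1 / (Fintype.card (State P) : ℝ) :=
    Finset.sum_lt_sum_of_nonempty ⟨startState P, Finset.mem_univ _⟩ fun s _ => h s
  have hc : (Fintype.card (State P) : ℝ) ≠ 0 := by
    have : 0 < Fintype.card (State P) := Fintype.card_pos_iff.2 ⟨startState P⟩
    positivity
  rw [b.sum_one] at h1
  simp [hc] at h1

/-- The belief that is certain of the state `s`. -/
def Belief.dirac (s : State P) : Belief P where
  mass s' := if s' = s then 1 else 0
  obs := s.1.observe
  nonneg s' := by split_ifs <;> simp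
  sum_one := by simp
  consistent s' h := by
    by_cases e : s' = s
    · rw [e]
    · simp [e] at h

/-- A finite set containing every action that is available in some state. -/
def actions (P : Params) : Finset Action :=
  insert .adopt ((Finset.range (P.N + 1)).image .publish)

lemma Belief.mem_actions (b : Belief P) {a : Action} (h : Available P b.obs a) :
    a ∈ actions P := by
  cases a with
  | adopt => simp [actions]
  | publish k =>
    obtain ⟨s, hs⟩ := b.exists_mass_pos
    have hs' := b.consistent s hs.ne'
    have h1 : k ≤ b.obs.l1 := h.1
    have h2 : s.1.l1 ≤ P.N := s.2.1
    have h3 : b.obs.l1 = s.1.l1 := by rw [← hs']; rfl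
    simp only [actions, Finset.mem_insert, Finset.mem_image, Finset.mem_range]
    exact Or.inr ⟨k, by omega, rfl⟩

lemma available_adopt (o : Obs) : Available P o .adopt := trivial

/-- A bound for the weighted rewards of available actions. -/
def rewardBound (P : Params) (ρ : ℝ) : ℝ :=
  ∑ s : State P, ∑ a ∈ actions P, |weigh ρ (reward P s a)|

lemma rewardBound_nonneg (P : Params) (ρ : ℝ) : 0 ≤ rewardBound P ρ :=
  Finset.sum_nonneg fun _ _ => Finset.sum_nonneg fun _ _ => abs_nonneg _

lemma Belief.abs_gain_le (ρ : ℝ) (b : Belief P) {a : Action} (h : Available P b.obs a) :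
    |b.gain ρ a| ≤ rewardBound P ρ := by
  have ha := b.mem_actions h
  rw [b.gain_eq]
  refine (Finset.abs_sum_le_sum_abs _ _).trans (Finset.sum_le_sum fun s _ => ?_)
  rw [abs_mul, abs_of_nonneg (b.nonneg s)]
  refine (mul_le_of_le_one_left (abs_nonneg _) (b.mass_le_one s)).trans ?_
  exact Finset.single_le_sum (f := fun a => |weigh ρ (reward P s a)|)
    (fun _ _ => abs_nonneg _) ha

/-- The finite set of observations made in some state. -/
def observations (P : Params) : Finset Obs := Finset.univ.image fun s : State P => s.1.observe

lemma Belief.obsProb_nonneg (b : Belief P) (a : Action) (o : Obs) : 0 ≤ b.obsProb a o :=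
  Finset.sum_nonneg fun s' _ => mul_nonneg (obsFun_nonneg s' a o) (b.predict_nonneg a s')

lemma sum_obsFun (s : State P) (a : Action) : ∑ o ∈ observations P, obsFun P s a o = 1 := by
  simp [obsFun, observations]

lemma Belief.sum_obsProb (b : Belief P) (a : Action) :
    ∑ o ∈ observations P, b.obsProb a o = 1 := by
  simp only [Belief.obsProb]
  rw [Finset.sum_comm]
  simp only [← Finset.sum_mul, sum_obsFun, one_mul, b.predict_sum]

lemma Belief.obsProb_eq_zero (b : Belief P) (a : Action) {o : Obs} (h : o ∉ observations P) :
    b.obsProb a o = 0 := by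
  refine Finset.sum_eq_zero fun s _ => ?_
  have : s.1.observe ≠ o := fun e =>
    h (by simp only [observations, Finset.mem_image]; exact ⟨s, by simp, e⟩)
  simp [obsFun, this]

lemma Belief.predict_le_obsProb (b : Belief P) (a : Action) (s : State P) :
    b.predict a s ≤ b.obsProb a s.1.observe := by
  have := Finset.single_le_sum (f := fun s' => obsFun P s' a s.1.observe * b.predict a s')
    (fun s' _ => mul_nonneg (obsFun_nonneg s' a _) (b.predict_nonneg a s')) (Finset.mem_univ s)
  simpa [obsFun, Belief.obsProb] using this

/-- Bayes' rule without division. -/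
lemma Belief.obsProb_mul_update_mass (b : Belief P) (a : Action) (o : Obs) (s : State P) :
    b.obsProb a o * (b.update a o).mass s = obsFun P s a o * b.predict a s := by
  by_cases h : 0 < b.obsProb a o
  · simp only [Belief.update, h, dif_pos]
    field_simp
  · have h0 : b.obsProb a o = 0 := le_antisymm (not_lt.1 h) (b.obsProb_nonneg a o)
    have h1 := (Finset.sum_eq_zero_iff_of_nonneg fun s' _ =>
      mul_nonneg (obsFun_nonneg s' a o) (b.predict_nonneg a s')).1 h0 s (Finset.mem_univ s)
    rw [h0, h1, zero_mul]

lemma Belief.update_obs (b : Belief P) (a : Action) {o : Obs} (h : 0 < b.obsProb a o) :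
    (b.update a o).obs = o := by
  simp [Belief.update, h]

/-- The expected value of `f` at the next belief when action `a` is taken at the belief `b`. -/
def Belief.expect (b : Belief P) (a : Action) (f : Belief P → ℝ) : ℝ :=
  ∑ o ∈ observations P, b.obsProb a o * f (b.update a o)

lemma Belief.expect_mono (b : Belief P) (a : Action) {f g : Belief P → ℝ} (h : ∀ b, f b ≤ g b) :
    b.expect a f ≤ b.expect a g :=
  Finset.sum_le_sum fun o _ => mul_le_mul_of_nonneg_left (h _) (b.obsProb_nonneg a o)

@[simp]
lemma Belief.expect_const (b : Belief P) (a : Action) (c : ℝ) : b.expect a (fun _ => c) = c := by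
  simp [Belief.expect, ← Finset.sum_mul, b.sum_obsProb]

lemma Belief.expect_add (b : Belief P) (a : Action) (f g : Belief P → ℝ) :
    b.expect a (fun x => f x + g x) = b.expect a f + b.expect a g := by
  simp [Belief.expect, mul_add, Finset.sum_add_distrib]

lemma Belief.expect_sub (b : Belief P) (a : Action) (f g : Belief P → ℝ) :
    b.expect a (fun x => f x - g x) = b.expect a f - b.expect a g := by
  simp [Belief.expect, mul_sub, Finset.sum_sub_distrib]

lemma Belief.expect_mul_const (b : Belief P) (a : Action) (f : Belief P → ℝ) (c : ℝ) :
    b.expect a (fun x => f x * c) = b.expect a f * c := by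
  simp [Belief.expect, Finset.sum_mul, mul_assoc]

/-- The next belief is, on average, the prediction. -/
lemma Belief.expect_mass (b : Belief P) (a : Action) (s : State P) :
    b.expect a (fun b' => b'.mass s) = b.predict a s := by
  simp only [Belief.expect, b.obsProb_mul_update_mass, ← Finset.sum_mul, sum_obsFun, one_mul]

lemma Belief.abs_expect_le (b : Belief P) (a : Action) {f : Belief P → ℝ} {c : ℝ}
    (h : ∀ b, |f b| ≤ c) : |b.expect a f| ≤ c := by
  rw [abs_le]
  constructor
  · simpa using b.expect_mono a (f := fun _ => -c) fun x => (abs_le.1 (h x)).1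
  · simpa using b.expect_mono a (g := fun _ => c) fun x => (abs_le.1 (h x)).2

lemma Belief.mass_mul_trans_le_predict (b : Belief P) (a : Action) (s s' : State P) :
    b.mass s * trans P s a s' ≤ b.predict a s' := by
  rw [mul_comm]
  exact Finset.single_le_sum (f := fun s => trans P s a s' * b.mass s)
    (fun s _ => mul_nonneg (trans_nonneg P s a s') (b.nonneg s)) (Finset.mem_univ s)

/-! ### The discounted problem -/

/-- `V` is a bounded solution of the optimality equation with discount factor `l`. -/
structure IsDiscountedValue (P : Params) (ρ l : ℝ) (V : Belief P → ℝ) : Prop where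
  ge : ∀ b a, Available P b.obs a → b.gain ρ a + l * b.expect a V ≤ V b
  attained : ∀ b, ∃ a, Available P b.obs a ∧ V b = b.gain ρ a + l * b.expect a V
  bound : ∀ b, (1 - l) * |V b| ≤ rewardBound P ρ

open Classical in
/-- The actions available at a belief. -/
def Belief.available (b : Belief P) : Finset Action :=
  (actions P).filter (Available P b.obs)

lemma Belief.mem_available (b : Belief P) (a : Action) :
    a ∈ b.available ↔ Available P b.obs a := by
  simp only [Belief.available, Finset.mem_filter, and_iff_right_iff_imp]
  exact b.mem_actions

lemma Belief.available_nonempty (b : Belief P) : b.available.Nonempty :=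
  ⟨.adopt, (b.mem_available _).2 (available_adopt _)⟩

/-- The Bellman operator with discount factor `l`. -/
def bellman (ρ l : ℝ) (V : Belief P → ℝ) (b : Belief P) : ℝ :=
  b.available.sup' b.available_nonempty fun a => b.gain ρ a + l * b.expect a V

lemma bellman_le_of_dist (ρ : ℝ) {l c : ℝ} (hl : 0 ≤ l) {V W : Belief P → ℝ}
    (h : ∀ b, V b ≤ W b + c) (b : Belief P) : bellman ρ l V b ≤ bellman ρ l W b + l * c := by
  refine Finset.sup'_le _ _ fun a ha => ?_
  have h1 := Finset.le_sup' (fun a => b.gain ρ a + l * b.expect a W) ha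
  have h2 := b.expect_mono a h
  rw [b.expect_add, b.expect_const] at h2
  have h3 := mul_le_mul_of_nonneg_left h2 hl
  unfold bellman
  linarith

lemma abs_bellman_le (ρ : ℝ) {l c : ℝ} (hl : 0 ≤ l) {V : Belief P → ℝ}
    (h : ∀ b, |V b| ≤ c) (b : Belief P) : |bellman ρ l V b| ≤ rewardBound P ρ + l * c := by
  obtain ⟨a, ha, e⟩ := Finset.exists_mem_eq_sup' b.available_nonempty
    fun a => b.gain ρ a + l * b.expect a V
  unfold bellman
  rw [e]
  refine (abs_add_le _ _).trans (add_le_add (b.abs_gain_le ρ ((b.mem_available a).1 ha)) ?_)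
  rw [abs_mul, abs_of_nonneg hl]
  exact mul_le_mul_of_nonneg_left (b.abs_expect_le a h) hl

/-- The Bellman operator is a contraction of the bounded functions. -/
lemma exists_isDiscountedValue (ρ : ℝ) {l : ℝ} (hl0 : 0 ≤ l) (hl1 : l < 1) :
    ∃ V : Belief P → ℝ, IsDiscountedValue P ρ l V := by
  let _ : TopologicalSpace (Belief P) := ⊥
  have _ : DiscreteTopology (Belief P) := ⟨rfl⟩
  let T : BoundedContinuousFunction (Belief P) ℝ → BoundedContinuousFunction (Belief P) ℝ :=
    fun V => BoundedContinuousFunction.ofNormedAddCommGroup (bellman ρ l V)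
      continuous_of_discreteTopology (rewardBound P ρ + l * ‖V‖) fun b =>
        abs_bellman_le ρ hl0 (fun b => V.norm_coe_le_norm b) b
  have hT : ContractingWith ⟨l, hl0⟩ T := by
    refine ⟨by exact_mod_cast hl1, LipschitzWith.of_dist_le_mul fun V W => ?_⟩
    refine (BoundedContinuousFunction.dist_le (by positivity)).2 fun b => ?_
    have h1 : ∀ b, V b ≤ W b + dist V W := fun b => by
      have := (abs_le.1 ((Real.dist_eq _ _).symm.le.trans (V.dist_coe_le_dist (g := W) b))).2
      linarith
    have h2 : ∀ b, W b ≤ V b + dist V W := fun b => by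
      have := (abs_le.1 ((Real.dist_eq _ _).symm.le.trans (V.dist_coe_le_dist (g := W) b))).1
      linarith
    have h3 := bellman_le_of_dist ρ hl0 h1 b
    have h4 := bellman_le_of_dist ρ hl0 h2 b
    rw [Real.dist_eq, abs_le]
    change -(l * dist V W) ≤ bellman ρ l V b - bellman ρ l W b ∧
      bellman ρ l V b - bellman ρ l W b ≤ l * dist V W
    constructor <;> linarith
  let V := hT.fixedPoint T
  have hV : ∀ b, bellman ρ l V b = V b := fun b =>
    congrArg (fun F : BoundedContinuousFunction (Belief P) ℝ => F b) hT.fixedPoint_isFixedPt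
  have hn : ‖V‖ ≤ rewardBound P ρ + l * ‖V‖ :=
    (BoundedContinuousFunction.norm_le
      (add_nonneg (rewardBound_nonneg P ρ) (by positivity))).2 fun b => by
      rw [← hV b]
      exact abs_bellman_le ρ hl0 (fun b => V.norm_coe_le_norm b) b
  refine ⟨V, fun b a ha => ?_, fun b => ?_, fun b => ?_⟩
  · rw [← hV b]
    exact Finset.le_sup' (fun a => b.gain ρ a + l * b.expect a V) ((b.mem_available a).2 ha)
  · obtain ⟨a, ha, e⟩ := Finset.exists_mem_eq_sup' b.available_nonempty
      fun a => b.gain ρ a + l * b.expect a V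
    exact ⟨a, (b.mem_available a).1 ha, by rw [← e, ← hV b]; rfl⟩
  · have h1 : |V b| ≤ ‖V‖ := V.norm_coe_le_norm b
    have h2 := mul_le_mul_of_nonneg_left h1 (sub_nonneg.2 hl1.le)
    linarith

/-! ### Convexity of the discounted value -/

section Convexity

/-- `b` is the mixture of the beliefs `B i` with weights `c i`. -/
structure IsMixture (c : State P → ℝ) (B : State P → Belief P) (b : Belief P) : Prop where
  nonneg : ∀ i, 0 ≤ c i
  sum_one : ∑ i, c i = 1
  mass_eq : ∀ s, b.mass s = ∑ i, c i * (B i).mass s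

variable {c : State P → ℝ} {B : State P → Belief P} {b : Belief P}

/-- Components of positive weight carry the observation of the mixture. -/
lemma IsMixture.obs_eq (h : IsMixture c B b) {i : State P} (hi : 0 < c i) :
    (B i).obs = b.obs := by
  obtain ⟨s, hs⟩ := (B i).exists_mass_pos
  have h1 : c i * (B i).mass s ≤ ∑ i, c i * (B i).mass s :=
    Finset.single_le_sum (f := fun i => c i * (B i).mass s)
      (fun i _ => mul_nonneg (h.nonneg i) ((B i).nonneg s)) (Finset.mem_univ i)
  have h2 : 0 < b.mass s := by
    rw [h.mass_eq]
    exact (mul_pos hi hs).trans_le h1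
  rw [← (B i).consistent s hs.ne', b.consistent s h2.ne']

lemma IsMixture.sum_mul_eq (h : IsMixture c B b) (w : State P → ℝ) :
    ∑ s, b.mass s * w s = ∑ i, c i * ∑ s, (B i).mass s * w s := by
  simp only [h.mass_eq, Finset.sum_mul, Finset.mul_sum]
  rw [Finset.sum_comm]
  simp only [mul_assoc]

lemma IsMixture.gain_eq (h : IsMixture c B b) (ρ : ℝ) (a : Action) :
    b.gain ρ a = ∑ i, c i * (B i).gain ρ a := by
  simp only [Belief.gain_eq]
  exact h.sum_mul_eq _

lemma IsMixture.predict_eq (h : IsMixture c B b) (a : Action) (s' : State P) :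
    b.predict a s' = ∑ i, c i * (B i).predict a s' := by
  have := h.sum_mul_eq fun s => trans P s a s'
  simpa only [Belief.predict, mul_comm (trans P _ a s')] using this

lemma IsMixture.obsProb_eq (h : IsMixture c B b) (a : Action) (o : Obs) :
    b.obsProb a o = ∑ i, c i * (B i).obsProb a o := by
  simp only [Belief.obsProb, h.predict_eq, Finset.mul_sum]
  rw [Finset.sum_comm]
  simp only [mul_left_comm]

/-- Updating a mixture gives the mixture of the updated components, reweighted by how likely each
of them made the observation. -/
lemma IsMixture.update (h : IsMixture c B b) (a : Action) (o : Obs) (ho : 0 < b.obsProb a o) :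
    IsMixture (fun i => c i * (B i).obsProb a o / b.obsProb a o) (fun i => (B i).update a o)
      (b.update a o) where
  nonneg i := div_nonneg (mul_nonneg (h.nonneg i) ((B i).obsProb_nonneg a o)) ho.le
  sum_one := by rw [← Finset.sum_div, ← h.obsProb_eq, div_self ho.ne']
  mass_eq s := by
    have h1 := b.obsProb_mul_update_mass a o s
    rw [h.predict_eq] at h1
    rw [eq_comm, ← mul_right_inj' ho.ne', h1, Finset.mul_sum, Finset.mul_sum]
    refine Finset.sum_congr rfl fun i _ => ?_
    have h2 := (B i).obsProb_mul_update_mass a o s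
    rw [div_mul_eq_mul_div, mul_div_cancel₀ _ ho.ne', mul_assoc, h2]
    ring

/-- A defect of convexity that is uniformly bounded by `K` shrinks with the discount factor at
each application of the optimality equation. -/
lemma IsDiscountedValue.le_sum_add_pow {ρ l K : ℝ} {V : Belief P → ℝ}
    (hV : IsDiscountedValue P ρ l V) (hl0 : 0 ≤ l) (hK : ∀ b, 2 * |V b| ≤ K) (n : ℕ) :
    ∀ {c : State P → ℝ} {B : State P → Belief P} {b : Belief P}, IsMixture c B b →
      V b ≤ ∑ i, c i * V (B i) + l ^ n * K := by
  induction n with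
  | zero =>
    intro c B b h
    have h1 : ∑ i, c i * (-K / 2) ≤ ∑ i, c i * V (B i) :=
      Finset.sum_le_sum fun i _ => mul_le_mul_of_nonneg_left
        (by have := hK (B i); have := neg_abs_le (V (B i)); linarith) (h.nonneg i)
    rw [← Finset.sum_mul, h.sum_one] at h1
    have := hK b
    have := le_abs_self (V b)
    linarith
  | succ n ih =>
    intro c B b h
    obtain ⟨a, ha, e⟩ := hV.attained b
    have h1 : ∑ i, c i * ((B i).gain ρ a + l * (B i).expect a V) ≤ ∑ i, c i * V (B i) := by
      refine Finset.sum_le_sum fun i _ => ?_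
      rcases (h.nonneg i).eq_or_lt with h0 | h0
      · simp [← h0]
      · exact mul_le_mul_of_nonneg_left (hV.ge _ a (by rwa [h.obs_eq h0])) h0.le
    have h2 : b.expect a V ≤ ∑ i, c i * (B i).expect a V + l ^ n * K := by
      have h3 : ∀ o, b.obsProb a o * V (b.update a o) ≤
          ∑ i, c i * ((B i).obsProb a o * V ((B i).update a o)) +
            b.obsProb a o * (l ^ n * K) := by
        intro o
        rcases (b.obsProb_nonneg a o).eq_or_lt with h0 | h0
        · have h4 := h.obsProb_eq a o
          rw [← h0, eq_comm, Finset.sum_eq_zero_iff_of_nonneg fun i _ =>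
            mul_nonneg (h.nonneg i) ((B i).obsProb_nonneg a o)] at h4
          have h5 : ∑ i, c i * ((B i).obsProb a o * V ((B i).update a o)) = 0 :=
            Finset.sum_eq_zero fun i hi => by rw [← mul_assoc, h4 i hi, zero_mul]
          rw [h5, ← h0]
          simp
        · have h4 := mul_le_mul_of_nonneg_left (ih (h.update a o h0)) h0.le
          rw [mul_add, Finset.mul_sum] at h4
          refine h4.trans (le_of_eq ?_)
          congr 1
          refine Finset.sum_congr rfl fun i _ => ?_
          field_simp
      have h4 := Finset.sum_le_sum fun o (_ : o ∈ observations P) => h3 o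
      rw [Finset.sum_add_distrib, ← Finset.sum_mul, b.sum_obsProb, one_mul,
        Finset.sum_comm] at h4
      simpa only [Belief.expect, Finset.mul_sum] using h4
    have h5 := mul_le_mul_of_nonneg_left h2 hl0
    have h6 : ∑ i, c i * ((B i).gain ρ a + l * (B i).expect a V) =
        b.gain ρ a + l * ∑ i, c i * (B i).expect a V := by
      simp only [h.gain_eq, mul_add, Finset.sum_add_distrib, Finset.mul_sum]
      congr 1
      exact Finset.sum_congr rfl fun i _ => by ring
    rw [e, pow_succ]
    linarith

lemma Belief.isMixture_dirac (b : Belief P) : IsMixture b.mass Belief.dirac b where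
  nonneg := b.nonneg
  sum_one := b.sum_one
  mass_eq s := by simp [Belief.dirac]

/-- Knowing the state cannot hurt. -/
lemma IsDiscountedValue.le_sum_dirac {ρ l : ℝ} {V : Belief P → ℝ}
    (hV : IsDiscountedValue P ρ l V) (hl0 : 0 ≤ l) (hl1 : l < 1) (b : Belief P) :
    V b ≤ ∑ s, b.mass s * V (Belief.dirac s) := by
  have hl : 0 < 1 - l := sub_pos.2 hl1
  have hK : ∀ b, 2 * |V b| ≤ 2 * (rewardBound P ρ / (1 - l)) := fun b => by
    have := (le_div_iff₀' hl).2 (hV.bound b)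
    linarith
  have h1 : Filter.Tendsto (fun n : ℕ => ∑ s, b.mass s * V (Belief.dirac s) +
      l ^ n * (2 * (rewardBound P ρ / (1 - l)))) Filter.atTop
      (nhds (∑ s, b.mass s * V (Belief.dirac s) + 0 * (2 * (rewardBound P ρ / (1 - l))))) :=
    ((tendsto_pow_atTop_nhds_zero_of_lt_one hl0 hl1).mul_const _).const_add _
  rw [zero_mul, add_zero] at h1
  exact ge_of_tendsto' h1 fun n => hV.le_sum_add_pow hl0 hK n b.isMixture_dirac

end Convexity

/-! ### Recurrence of a state -/

/-- All miners start from the same public chain and Alice hides one block. -/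
def aheadState (P : Params) : State P :=
  ⟨⟨.three, .ir, 1, 0, 0, 0, 0, 0, 0, 0⟩, by simpa [IsState] using P.N_pos⟩

/-- A lower bound for the probabilities of the branches used to reach `aheadState`. -/
def minProb (P : Params) : ℝ := P.α1 * P.α2 * P.p / 2

lemma minProb_pos (P : Params) : 0 < minProb P := by
  have := P.α1_pos; have := P.α2_pos; have := P.p_pos
  unfold minProb; positivity

lemma minProb_le_alice (P : Params) : minProb P ≤ P.α1 * P.p := by
  have h1 := P.α1_pos; have h2 := P.α2_pos; have h3 := P.p_pos
  have h4 : P.α2 ≤ 1 := by linarith [P.α_sum, P.αh_pos]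
  have h5 : 0 < P.α1 * P.p := by positivity
  unfold minProb
  nlinarith

lemma minProb_le_half_bob (P : Params) : minProb P ≤ P.α2 * P.p * (1 / 2) := by
  have h1 := P.α1_pos; have h2 := P.α2_pos; have h3 := P.p_pos
  have h4 : P.α1 ≤ 1 := by linarith [P.α_sum, P.αh_pos]
  have h5 : 0 < P.α2 * P.p := by positivity
  unfold minProb
  nlinarith

lemma minProb_le_bob (P : Params) : minProb P ≤ P.α2 * P.p := by
  have h5 : 0 < P.α2 * P.p := mul_pos P.α2_pos P.p_pos
  linarith [minProb_le_half_bob P]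

lemma minProb_le_one (P : Params) : minProb P ≤ 1 := by
  have h4 : P.α1 ≤ 1 := by linarith [P.α_sum, P.αh_pos, P.α2_pos]
  have h1 := P.α1_pos; have h3 := P.p_pos; have h5 := P.p_le
  have := minProb_le_alice P
  nlinarith

lemma prob_le_trans (s : State P) (a : Action) {br : Branch} (h : br ∈ rows P s a) :
    br.prob ≤ trans P s a (land P br.next) := by
  have h1 := List.single_le_sum (l := (rows P s a).map fun br' =>
    if land P br'.next = land P br.next then br'.prob else 0) (by
      intro x hx
      obtain ⟨br', hbr', rfl⟩ := List.mem_map.1 hx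
      split_ifs
      exacts [rows_nonneg P s a br' hbr', le_rfl])
    br.prob (List.mem_map.2 ⟨br, h, by simp⟩)
  exact h1

/-- This is `1` if Bob's chain is level with the public chain in a fork, and `0` otherwise. In such
a fork, a block mined by Bob resolves the fork instead of adding to his hidden blocks. -/
def tieFlag (c : Config) : ℕ :=
  if c.l2 + c.h2 = c.h3 ∧ c.fork ≠ .ir ∧ c.fork ≠ .r then 1 else 0

/-- A potential that falls whenever Bob mines, under any action of Alice, as long as the length
limits are respected. -/
def potential (P : Params) (c : Config) : ℕ :=
  c.l1 * (2 * (P.N + 1)) + tieFlag c * (P.N + 1) + (P.N - c.l2)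

/-- Lexicographic descent with respect to `l₁`, the tie flag and `-l₂`. -/
def Descends (c c' : Config) : Prop :=
  c'.l1 < c.l1 ∨ (c'.l1 ≤ c.l1 ∧ tieFlag c' < tieFlag c) ∨
    (c'.l1 ≤ c.l1 ∧ tieFlag c' ≤ tieFlag c ∧ c.l2 < c'.l2)

lemma tieFlag_le_one (c : Config) : tieFlag c ≤ 1 := by
  unfold tieFlag; split_ifs <;> simp

lemma Descends.potential_lt {c c' : Config} (h : Descends c c') (h' : IsState P c') :
    potential P c' < potential P c := by
  have h1 : c'.l2 ≤ P.N := h'.2.1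
  have h2 := tieFlag_le_one c'
  unfold potential
  rcases h with h | ⟨h, h3⟩ | ⟨h, h3, h4⟩
  · have h3 := Nat.mul_le_mul_right (2 * (P.N + 1)) (Nat.succ_le_of_lt h)
    have := Nat.mul_le_mul_right (P.N + 1) h2
    rw [Nat.succ_mul] at h3
    omega
  · have := Nat.mul_le_mul_right (2 * (P.N + 1)) h
    have h4 := Nat.mul_le_mul_right (P.N + 1) (Nat.succ_le_of_lt h3)
    rw [Nat.succ_mul] at h4
    omega
  · have := Nat.mul_le_mul_right (2 * (P.N + 1)) h
    have := Nat.mul_le_mul_right (P.N + 1) h3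
    omega

/-- The list `L` has a branch of probability at least `minProb P` that descends from `s`. In the
transition tables such a branch is found among those in which Bob mines. -/
def IsDescent (P : Params) (s : Config) (L : List Branch) : Prop :=
  ∃ br ∈ L, minProb P ≤ br.prob ∧ Descends s br.next

lemma isDescent_slot {s : Config} {w : ℝ × ℝ × ℝ} {c0 c1 c2 c3 : Config} (h : Descends s c2) :
    IsDescent P s (slot P w c0 c1 c2 c3) :=
  ⟨⟨P.α2 * P.p, c2, w⟩, by simp [slot], minProb_le_bob P, h⟩

lemma isDescent_third {s : Config} {w : ℝ × ℝ × ℝ} {b0 b1 : Branch} {c : Config} {L : List Branch}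
    (h : Descends s c) : IsDescent P s (b0 :: b1 :: ⟨P.α2 * P.p, c, w⟩ :: L) :=
  ⟨⟨P.α2 * P.p, c, w⟩, by simp, minProb_le_bob P, h⟩

lemma isDescent_fourth {s : Config} {w : ℝ × ℝ × ℝ} {b0 b1 b2 : Branch} {c : Config}
    {L : List Branch} (h : Descends s c) :
    IsDescent P s (b0 :: b1 :: b2 :: ⟨P.α2 * P.p, c, w⟩ :: L) :=
  ⟨⟨P.α2 * P.p, c, w⟩, by simp, minProb_le_bob P, h⟩

/-- One of the two outcomes of a tie has probability at least one half. -/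
lemma isDescent_split {s : Config} {w w' : ℝ × ℝ × ℝ} {b0 b1 : Branch} {c c' : Config}
    {L : List Branch} (h : Descends s c) (h' : Descends s c') :
    IsDescent P s (b0 :: b1 :: ⟨P.α2 * P.p * P.γ1, c, w⟩ ::
      ⟨P.α2 * P.p * (1 - P.γ1), c', w'⟩ :: L) := by
  have h0 := minProb_le_half_bob P
  have h5 : 0 < P.α2 * P.p := mul_pos P.α2_pos P.p_pos
  rcases le_total (1 / 2) P.γ1 with hg | hg
  · exact ⟨⟨P.α2 * P.p * P.γ1, c, w⟩, by simp, h0.trans (mul_le_mul_of_nonneg_left hg h5.le), h⟩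
  · exact ⟨⟨P.α2 * P.p * (1 - P.γ1), c', w'⟩, by simp,
      h0.trans (mul_le_mul_of_nonneg_left (by linarith) h5.le), h'⟩

lemma isDescent_adopt (s : State P) : IsDescent P s (adoptRows P s) := by
  obtain ⟨⟨loc, fork, l1, l2, h1, h2, h3, u1, u2, u3⟩, hs⟩ := s
  obtain ⟨-, -, -, -, -, hs1, hs2, -, -, -⟩ := hs
  simp only at hs1 hs2
  simp only [adoptRows]
  split_ifs <;>
    first
    | apply isDescent_slot
    | apply isDescent_fourth
  all_goals
    simp only [Descends, tieFlag]
    simp_all <;> (try split_ifs) <;> grind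

lemma isDescent_publish (s : State P) {a : ℕ} (ha : a ≤ s.1.l1) :
    IsDescent P s (rows P s (.publish a)) := by
  revert ha
  obtain ⟨⟨loc, fork, l1, l2, h1, h2, h3, u1, u2, u3⟩, hs⟩ := s
  obtain ⟨-, -, -, hs0, -, hs1, hs2, -, -, -⟩ := hs
  intro (ha : a ≤ l1)
  simp only at hs0 hs1 hs2
  simp only [rows]
  split_ifs <;>
    simp only [overrideRows, tieRows, levelRows, behindRows, matchBobRows, oneBehindRows,
      leadRows] <;>
    (try split) <;> (try split_ifs) <;>
    first
    | apply isDescent_slot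
    | apply isDescent_third
    | apply isDescent_split
  all_goals
    simp only [Descends, tieFlag]
    rcases Nat.eq_zero_or_pos a with h0 | h0 <;> grind

lemma isDescent_rows (s : State P) {a : Action} (ha : Available P s.1.observe a) :
    IsDescent P s (rows P s a) := by
  cases a with
  | adopt => exact isDescent_adopt s
  | publish k => exact isDescent_publish s ha.1

/-- From the start of a round, `aheadState` is reached when Alice mines. -/
lemma minProb_le_trans_startState {a : Action}
    (ha : Available P (startState P).1.observe a) :
    minProb P ≤ trans P (startState P) a (aheadState P) := by
  have hl : land P (aheadState P).1 = aheadState P := dif_pos (aheadState P).2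
  have key : ∃ br ∈ rows P (startState P) a, br.prob = P.α1 * P.p ∧
      br.next = (aheadState P).1 := by
    cases a with
    | adopt => simp [startState, rows, adoptRows, slot, aheadState]
    | publish k =>
      have hk : k = 0 := Nat.le_zero.1 ha.1
      subst hk
      simp [startState, rows, levelRows, slot, aheadState]
  obtain ⟨br, hbr, h1, h2⟩ := key
  have h3 := prob_le_trans (startState P) a hbr
  rw [h2, hl, h1] at h3
  exact (minProb_le_alice P).trans h3

/-- A bound for the number of slots after which `aheadState` can be reached, whatever Alice does. -/
def rank (s : State P) : ℕ :=
  if s = aheadState P then 0 else if s = startState P then 1 else potential P s + 2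

lemma rank_le (s : State P) : rank s ≤ potential P s + 2 := by
  unfold rank; split_ifs <;> omega

lemma rank_startState_le : rank (startState P) ≤ 1 := by
  unfold rank; split_ifs <;> simp_all

/-- Whatever Alice does, the rank falls with positive probability. -/
lemma exists_rank_lt (s : State P) (hs : s ≠ aheadState P) {a : Action}
    (ha : Available P s.1.observe a) :
    ∃ s', minProb P ≤ trans P s a s' ∧ rank s' < rank s := by
  by_cases h0 : s = startState P
  · subst h0
    refine ⟨aheadState P, minProb_le_trans_startState ha, ?_⟩
    simp [rank, hs]
  · obtain ⟨br, hbr, h1, h2⟩ := isDescent_rows s ha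
    refine ⟨land P br.next, h1.trans (prob_le_trans s a hbr), ?_⟩
    have h3 : rank s = potential P s + 2 := by simp [rank, hs, h0]
    rw [h3]
    by_cases h : IsState P br.next
    · have h4 : land P br.next = ⟨br.next, h⟩ := dif_pos h
      have h5 := h2.potential_lt h
      have h6 := rank_le (land P br.next)
      rw [h4] at h6 ⊢
      exact h6.trans_lt (Nat.add_lt_add_right h5 2)
    · have h4 : land P br.next = startState P := dif_neg h
      rw [h4]
      have := rank_startState_le (P := P)
      omega

lemma available_publish_one :
    Available P (aheadState P).1.observe (.publish 1) := by
  have := P.H_pos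
  simp [Available, aheadState, Config.observe]

/-- If Alice releases her only hidden block when the public chain is empty, and again hides one block
behind an empty public chain afterwards, then she has overridden and the state is `aheadState`. -/
lemma eq_aheadState_of_trans (s : State P) (hs : s.1.observe = (aheadState P).1.observe)
    {s' : State P} (hs' : s'.1.observe = (aheadState P).1.observe)
    (h : trans P s (.publish 1) s' ≠ 0) : s' = aheadState P := by
  have key : ∀ br ∈ rows P s (.publish 1), land P br.next = s' → br.next = (aheadState P).1 := by
    intro br hbr hl
    have h1 : br.next.observe = (aheadState P).1.observe := by
      by_cases hi : IsState P br.next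
      · rw [← hs', ← hl, land, dif_pos hi]
      · rw [← hl, land, dif_neg hi] at hs'
        simp [startState, aheadState, Config.observe] at hs'
    clear hl h
    revert hbr
    obtain ⟨⟨loc, fork, l1, l2, h1, h2, h3, u1, u2, u3⟩, hst⟩ := s
    simp only [Config.observe, aheadState, Obs.mk.injEq] at hs
    obtain ⟨rfl, rfl, rfl, rfl, rfl⟩ := hs
    obtain rfl : h2 = 0 := Nat.le_zero.1 hst.2.2.2.2.1
    simp only [rows]
    simp only [Config.observe, aheadState, Obs.mk.injEq] at h1 ⊢
    split_ifs <;>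
      simp only [overrideRows, tieRows, levelRows, behindRows, matchBobRows, oneBehindRows,
        leadRows, slot] <;>
      (try split_ifs) <;> intro hbr <;>
      simp only [List.mem_cons, List.not_mem_nil, or_false] at hbr <;>
      grind
  by_contra hne
  apply h
  refine List.sum_eq_zero fun x hx => ?_
  obtain ⟨br, hbr, rfl⟩ := List.mem_map.1 hx
  refine if_neg fun hl => hne ?_
  rw [← hl]
  have h2 := key br hbr hl
  have h3 : land P (aheadState P).1 = aheadState P := dif_pos (aheadState P).2
  rw [h2, h3]

lemma minProb_le_trans_aheadState :
    minProb P ≤ trans P (aheadState P) (.publish 1) (aheadState P) := by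
  have hl : land P (aheadState P).1 = aheadState P := dif_pos (aheadState P).2
  have hbr : (⟨P.α1 * P.p, (aheadState P).1, (1, 0, 0)⟩ : Branch) ∈
      rows P (aheadState P) (.publish 1) := by
    simp [aheadState, rows, overrideRows, slot]
  have h3 := prob_le_trans (aheadState P) (.publish 1) hbr
  rw [hl] at h3
  exact (minProb_le_alice P).trans h3

/-! ### The discounted values have uniformly bounded oscillation -/

section Oscillation

variable {ρ l : ℝ} {V : Belief P → ℝ}

lemma minProb_half_nonneg : 0 ≤ minProb P / 2 := by
  have := minProb_pos P; linarith

lemma minProb_half_pow_le_one (j : ℕ) : (minProb P / 2) ^ j ≤ 1 :=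
  pow_le_one₀ minProb_half_nonneg (by linarith [minProb_le_one P, minProb_pos P])

lemma minProb_half_mul_mass_le (hl : 1 / 2 ≤ l) (b : Belief P) (a : Action) {s s' : State P}
    (h : minProb P ≤ trans P s a s') :
    minProb P / 2 * b.mass s ≤ l * b.predict a s' := by
  have h1 := b.mass_mul_trans_le_predict a s s'
  have h2 := mul_le_mul_of_nonneg_left h (b.nonneg s)
  have h3 := b.predict_nonneg a s'
  nlinarith

/-- Since the true state may reach `aheadState`, whatever Alice does, and since full knowledge of the
state cannot hurt, a belief is worth less than the best belief by a fixed fraction of the deficit of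
`aheadState`, up to bounded rewards. Discounting costs at most a factor `1 / 2` per slot, which is why
the powers are those of `minProb P / 2`. -/
lemma IsDiscountedValue.le_sub (hV : IsDiscountedValue P ρ l V) (hl : 1 / 2 ≤ l) (hl1 : l < 1)
    {M : ℝ} (hM : ∀ b, V b ≤ M) (j : ℕ) :
    ∀ s, rank s ≤ j → ∀ b : Belief P, V b ≤ M + 2 * rewardBound P ρ * j -
      b.mass s * ((minProb P / 2) ^ j * (M - V (Belief.dirac (aheadState P)))) := by
  have hR := rewardBound_nonneg P ρ
  have hlM : ∀ _b : Belief P, l * M ≤ M + rewardBound P ρ := fun b => by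
    have h1 := hV.bound b
    have h2 := neg_abs_le (V b)
    have h3 := hM b
    have h4 : (1 - l) * -|V b| ≤ (1 - l) * M :=
      mul_le_mul_of_nonneg_left (h2.trans h3) (by linarith)
    linarith
  have hD : 0 ≤ M - V (Belief.dirac (aheadState P)) := sub_nonneg.2 (hM _)
  have hκ := minProb_half_nonneg (P := P)
  have base : ∀ j : ℕ, ∀ b : Belief P, V b ≤ M + 2 * rewardBound P ρ * j -
      b.mass (aheadState P) *
        ((minProb P / 2) ^ j * (M - V (Belief.dirac (aheadState P)))) := by
    intro j b
    have h1 := hV.le_sum_dirac (by linarith) hl1 b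
    have h2 : ∑ s, b.mass s * V (Belief.dirac s) ≤
        ∑ s, b.mass s * (M - (if s = aheadState P then 1 else 0) *
          (M - V (Belief.dirac (aheadState P)))) := by
      refine Finset.sum_le_sum fun s _ => mul_le_mul_of_nonneg_left ?_ (b.nonneg s)
      split_ifs with h
      · rw [h]; linarith
      · simpa using hM _
    have h3 : ∑ s, b.mass s * (M - (if s = aheadState P then 1 else 0) *
          (M - V (Belief.dirac (aheadState P)))) =
        M - b.mass (aheadState P) * (M - V (Belief.dirac (aheadState P))) := by
      simp [mul_sub, Finset.sum_sub_distrib, ← Finset.sum_mul, b.sum_one]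
    have h4 := mul_le_of_le_one_left hD (minProb_half_pow_le_one (P := P) j)
    have h5 := mul_le_mul_of_nonneg_left h4 (b.nonneg (aheadState P))
    have h6 : 0 ≤ 2 * rewardBound P ρ * j := by positivity
    linarith
  induction j with
  | zero =>
    intro s hs b
    by_cases h : s = aheadState P
    · rw [h]; exact base 0 b
    · obtain ⟨s', -, h'⟩ := exists_rank_lt s h (available_adopt _)
      omega
  | succ j ih =>
    intro s hs b
    by_cases h : s = aheadState P
    · rw [h]; exact base _ b
    rcases (b.nonneg s).eq_or_lt with h0 | h0
    · rw [← h0]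
      have : 0 ≤ 2 * rewardBound P ρ * (j + 1 : ℕ) := by positivity
      linarith [hM b]
    obtain ⟨a, ha, e⟩ := hV.attained b
    obtain ⟨s', hs1, hs2⟩ := exists_rank_lt s h (a := a) (by rwa [b.consistent s h0.ne'])
    have h1 := b.expect_mono a (ih s' (by omega))
    rw [b.expect_sub, b.expect_const, b.expect_mul_const, b.expect_mass] at h1
    have h2 := mul_le_mul_of_nonneg_left h1 (show (0 : ℝ) ≤ l by linarith)
    have h3 := minProb_half_mul_mass_le hl b a hs1
    have h4 : 0 ≤ (minProb P / 2) ^ j * (M - V (Belief.dirac (aheadState P))) := by positivity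
    have h5 := mul_le_mul_of_nonneg_right h3 h4
    have h6 := (abs_le.1 (b.abs_gain_le ρ ha)).2
    have h7 := hlM b
    have h8 : l * (2 * rewardBound P ρ * j) ≤ 2 * rewardBound P ρ * j :=
      mul_le_of_le_one_left (by positivity) hl1.le
    rw [e]
    push_cast
    rw [pow_succ]
    linarith

/-- After releasing one block at a belief that carries the observation of `aheadState`, that
observation reveals the state. -/
lemma Belief.update_publish_one (b : Belief P) (hb : b.obs = (aheadState P).1.observe)
    (h : 0 < b.predict (.publish 1) (aheadState P)) :
    b.update (.publish 1) (aheadState P).1.observe = Belief.dirac (aheadState P) := by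
  have ho : 0 < b.obsProb (.publish 1) (aheadState P).1.observe :=
    h.trans_le (b.predict_le_obsProb _ _)
  have hz : ∀ s, s ≠ aheadState P →
      (b.update (.publish 1) (aheadState P).1.observe).mass s = 0 := by
    intro s hs
    have h1 := b.obsProb_mul_update_mass (.publish 1) (aheadState P).1.observe s
    have h2 : obsFun P s (.publish 1) (aheadState P).1.observe * b.predict (.publish 1) s = 0 := by
      by_cases hso : s.1.observe = (aheadState P).1.observe
      · refine mul_eq_zero_of_right _ (Finset.sum_eq_zero fun s0 _ => ?_)
        by_contra hne
        obtain ⟨h3, h4⟩ := mul_ne_zero_iff.1 hne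
        exact hs (eq_aheadState_of_trans s0 ((b.consistent s0 h4).trans hb) hso h3)
      · simp [obsFun, hso]
    rw [h2] at h1
    exact (mul_eq_zero.1 h1).resolve_left ho.ne'
  refine Belief.ext_mass (funext fun s => ?_) (b.update_obs _ ho)
  by_cases hs : s = aheadState P
  · have h1 := (b.update (.publish 1) (aheadState P).1.observe).sum_one
    rw [Finset.sum_eq_single (aheadState P) (fun s _ => hz s) (by simp)] at h1
    rw [hs, h1]
    simp [Belief.dirac]
  · rw [hz s hs]
    simp [Belief.dirac, hs]

/-- Alice can, from any belief, make `aheadState` both occur and become known to her: she adopts while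
the true state is of positive rank, and releases one block when it is `aheadState`. The action may
depend on the unobserved state `s`, because the bound is claimed for each `s` separately. -/
lemma IsDiscountedValue.add_le (hV : IsDiscountedValue P ρ l V) (hl : 1 / 2 ≤ l) (hl1 : l < 1)
    {m : ℝ} (hm : ∀ b, m ≤ V b) (j : ℕ) :
    ∀ s, rank s ≤ j → ∀ b : Belief P,
      m - 2 * rewardBound P ρ * (j + 1 : ℕ) +
      b.mass s * ((minProb P / 2) ^ (j + 1) * (V (Belief.dirac (aheadState P)) - m)) ≤ V b := by
  have hR := rewardBound_nonneg P ρ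
  have hlm : ∀ _b : Belief P, m - rewardBound P ρ ≤ l * m := fun b => by
    have h1 := hV.bound b
    have h2 := le_abs_self (V b)
    have h3 := hm b
    have h4 : (1 - l) * m ≤ (1 - l) * |V b| :=
      mul_le_mul_of_nonneg_left (h3.trans h2) (by linarith)
    linarith
  have hD : 0 ≤ V (Belief.dirac (aheadState P)) - m := sub_nonneg.2 (hm _)
  have hκ := minProb_half_nonneg (P := P)
  have null : ∀ (j : ℕ) (s : State P) (b : Belief P), b.mass s = 0 →
      m - 2 * rewardBound P ρ * (j + 1 : ℕ) +
      b.mass s * ((minProb P / 2) ^ (j + 1) * (V (Belief.dirac (aheadState P)) - m)) ≤ V b := by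
    intro j s b h0
    rw [h0]
    have : 0 ≤ 2 * rewardBound P ρ * (j + 1 : ℕ) := by positivity
    linarith [hm b]
  have base : ∀ j : ℕ, ∀ b : Belief P, m - 2 * rewardBound P ρ * (j + 1 : ℕ) +
      b.mass (aheadState P) *
        ((minProb P / 2) ^ (j + 1) * (V (Belief.dirac (aheadState P)) - m)) ≤ V b := by
    intro j b
    rcases (b.nonneg (aheadState P)).eq_or_lt with h0 | h0
    · exact null j _ b h0.symm
    have hobs := b.consistent _ h0.ne'
    have ha : Available P b.obs (.publish 1) := hobs ▸ available_publish_one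
    have hp : 0 < b.predict (.publish 1) (aheadState P) :=
      (mul_pos h0 ((minProb_pos P).trans_le minProb_le_trans_aheadState)).trans_le
        (b.mass_mul_trans_le_predict _ _ _)
    have hu := b.update_publish_one hobs.symm hp
    have h1 : m + b.predict (.publish 1) (aheadState P) *
        (V (Belief.dirac (aheadState P)) - m) ≤ b.expect (.publish 1) V := by
      have h2 : ∀ o ∈ observations P, 0 ≤ b.obsProb (.publish 1) o *
          (V (b.update (.publish 1) o) - m) := fun o _ =>
        mul_nonneg (b.obsProb_nonneg _ _) (sub_nonneg.2 (hm _))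
      have h3 := Finset.single_le_sum h2 (a := (aheadState P).1.observe)
        (by simp only [observations, Finset.mem_image]; exact ⟨_, Finset.mem_univ _, rfl⟩)
      rw [hu] at h3
      have h4 := b.expect_sub (.publish 1) V fun _ => m
      rw [b.expect_const] at h4
      have h5 := mul_le_mul_of_nonneg_right
        (b.predict_le_obsProb (.publish 1) (aheadState P)) hD
      simp only [Belief.expect] at h3 h4 ⊢
      linarith
    have h2 := mul_le_mul_of_nonneg_left h1 (show (0 : ℝ) ≤ l by linarith)
    have h3 := minProb_half_mul_mass_le hl b _ (minProb_le_trans_aheadState (P := P))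
    have h4 := mul_le_mul_of_nonneg_right h3 hD
    have h5 := (abs_le.1 (b.abs_gain_le ρ ha)).1
    have h6 := hlm b
    have h7 := hV.ge b _ ha
    have h8 := mul_le_mul_of_nonneg_left (minProb_half_pow_le_one (P := P) j)
      (mul_nonneg (mul_nonneg hκ (b.nonneg (aheadState P))) hD)
    have h9 : 0 ≤ 2 * rewardBound P ρ * j := by positivity
    rw [pow_succ]
    push_cast
    linarith
  induction j with
  | zero =>
    intro s hs b
    by_cases h : s = aheadState P
    · rw [h]; exact base 0 b
    · obtain ⟨s', -, h'⟩ := exists_rank_lt s h (available_adopt _)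
      omega
  | succ j ih =>
    intro s hs b
    by_cases h : s = aheadState P
    · rw [h]; exact base _ b
    have ha : Available P b.obs .adopt := available_adopt _
    obtain ⟨s', hs1, hs2⟩ := exists_rank_lt s h (a := .adopt) (available_adopt _)
    have h1 := b.expect_mono .adopt (ih s' (by omega))
    rw [b.expect_add, b.expect_const, b.expect_mul_const, b.expect_mass] at h1
    have h2 := mul_le_mul_of_nonneg_left h1 (show (0 : ℝ) ≤ l by linarith)
    have h3 := minProb_half_mul_mass_le hl b _ hs1
    have h4 : 0 ≤ (minProb P / 2) ^ (j + 1) * (V (Belief.dirac (aheadState P)) - m) := by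
      positivity
    have h5 := mul_le_mul_of_nonneg_right h3 h4
    have h6 := (abs_le.1 (b.abs_gain_le ρ ha)).1
    have h7 := hlm b
    have h8 : l * (2 * rewardBound P ρ * (j + 1 : ℕ)) ≤ 2 * rewardBound P ρ * (j + 1 : ℕ) :=
      mul_le_of_le_one_left (by positivity) hl1.le
    have h9 := hV.ge b _ ha
    rw [pow_succ _ (j + 1)]
    push_cast at h2 h8 ⊢
    linarith

end Oscillation

/-- The oscillation of the discounted values is bounded uniformly in the discount factor. -/
lemma exists_abs_sub_le (P : Params) (ρ : ℝ) : ∃ C : ℝ, ∀ (l : ℝ) (V : Belief P → ℝ),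
    1 / 2 ≤ l → l < 1 → IsDiscountedValue P ρ l V →
      ∀ b, |V b - V (Belief.dirac (aheadState P))| ≤ C := by
  set J := Finset.univ.sup (rank (P := P))
  have hJ : ∀ s : State P, rank s ≤ J := fun s => Finset.le_sup (Finset.mem_univ s)
  have hn : (0 : ℝ) < Fintype.card (State P) := by
    exact_mod_cast Fintype.card_pos_iff.2 ⟨startState P⟩
  have hδ : 0 < 1 / (Fintype.card (State P) : ℝ) * (minProb P / 2) ^ (J + 1) := by
    have := minProb_pos P
    positivity
  refine ⟨2 * rewardBound P ρ * (J + 1 : ℕ) /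
    (1 / (Fintype.card (State P) : ℝ) * (minProb P / 2) ^ (J + 1)), fun l V hl hl1 hV b => ?_⟩
  set t := V (Belief.dirac (aheadState P))
  have hK : ∀ b, |V b| ≤ rewardBound P ρ / (1 - l) := fun b =>
    (le_div_iff₀' (sub_pos.2 hl1)).2 (hV.bound b)
  have hne : Nonempty (Belief P) := ⟨b⟩
  have hba : BddAbove (Set.range V) :=
    ⟨_, Set.forall_mem_range.2 fun b => (abs_le.1 (hK b)).2⟩
  have hbb : BddBelow (Set.range V) :=
    ⟨_, Set.forall_mem_range.2 fun b => (abs_le.1 (hK b)).1⟩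
  have hM : ∀ b, V b ≤ ⨆ b, V b := le_ciSup hba
  have hm : ∀ b, ⨅ b, V b ≤ V b := ciInf_le hbb
  have hκ : 0 ≤ (minProb P / 2) ^ (J + 1) := pow_nonneg minProb_half_nonneg _
  have up : (⨆ b, V b) - t ≤ 2 * rewardBound P ρ * (J + 1 : ℕ) /
      (1 / (Fintype.card (State P) : ℝ) * (minProb P / 2) ^ (J + 1)) := by
    rw [le_div_iff₀ hδ]
    have h1 : ∀ b, V b ≤ (⨆ b, V b) + 2 * rewardBound P ρ * (J + 1 : ℕ) -
        1 / (Fintype.card (State P) : ℝ) * ((minProb P / 2) ^ (J + 1) * ((⨆ b, V b) - t)) := by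
      intro b
      obtain ⟨s, hs⟩ := b.exists_mass_ge
      refine (hV.le_sub hl hl1 hM (J + 1) s ((hJ s).trans (Nat.le_succ J)) b).trans ?_
      have := mul_le_mul_of_nonneg_right hs (mul_nonneg hκ (sub_nonneg.2 (hM (Belief.dirac
        (aheadState P)))))
      linarith
    have h2 := ciSup_le h1
    linarith
  have down : t - (⨅ b, V b) ≤ 2 * rewardBound P ρ * (J + 1 : ℕ) /
      (1 / (Fintype.card (State P) : ℝ) * (minProb P / 2) ^ (J + 1)) := by
    rw [le_div_iff₀ hδ]
    have h1 : ∀ b, (⨅ b, V b) - 2 * rewardBound P ρ * (J + 1 : ℕ) +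
        1 / (Fintype.card (State P) : ℝ) * ((minProb P / 2) ^ (J + 1) * (t - (⨅ b, V b))) ≤ V b := by
      intro b
      obtain ⟨s, hs⟩ := b.exists_mass_ge
      refine le_trans ?_ (hV.add_le hl hl1 hm J s (hJ s) b)
      have := mul_le_mul_of_nonneg_right hs (mul_nonneg hκ (sub_nonneg.2 (hm (Belief.dirac
        (aheadState P)))))
      linarith
    have h2 := le_ciInf h1
    linarith
  rw [abs_le]
  constructor
  · linarith [hm b]
  · linarith [hM b]

/-! ### The average-reward optimality equation -/

/-- A bounded real sequence converges along every ultrafilter. -/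
lemma exists_tendsto_ultrafilter (U : Ultrafilter ℕ) {u : ℕ → ℝ} {C : ℝ} (h : ∀ n, |u n| ≤ C) :
    ∃ x, |x| ≤ C ∧ Filter.Tendsto u U (nhds x) := by
  have hc : (U.map u : Filter ℝ) ≤ Filter.principal (Set.Icc (-C) C) := by
    rw [Filter.le_principal_iff]
    exact Filter.mem_map.2 (Filter.univ_mem' fun n => abs_le.1 (h n))
  obtain ⟨x, hx, hxu⟩ := isCompact_Icc.ultrafilter_le_nhds (U.map u) hc
  exact ⟨x, abs_le.2 hx, hxu⟩

/-- The average-reward optimality equation: `g` is the optimal average reward, `h` the relative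
value of a belief, and `φ` selects optimal actions. -/
structure IsAverageSolution (P : Params) (ρ g C : ℝ) (h : Belief P → ℝ) (φ : Belief P → Action) :
    Prop where
  bound : ∀ b, |h b| ≤ C
  available : ∀ b, Available P b.obs (φ b)
  le : ∀ b a, Available P b.obs a → b.gain ρ a + b.expect a h ≤ g + h b
  eq : ∀ b, b.gain ρ (φ b) + b.expect (φ b) h = g + h b

/-- The vanishing discount limit, taken along an ultrafilter. -/
lemma exists_isAverageSolution (P : Params) (ρ : ℝ) : ∃ g C h φ, IsAverageSolution P ρ g C h φ := by
  obtain ⟨C, hC⟩ := exists_abs_sub_le P ρ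
  set l : ℕ → ℝ := fun n => 1 - 1 / ((n : ℝ) + 2) with hldef
  have hl0 : ∀ n, 1 / 2 ≤ l n := fun n => by
    have : 1 / ((n : ℝ) + 2) ≤ 1 / 2 :=
      one_div_le_one_div_of_le (by norm_num) (by linarith [n.cast_nonneg (α := ℝ)])
    simp only [hldef]; linarith
  have hl1 : ∀ n, l n < 1 := fun n => by
    have : 0 < 1 / ((n : ℝ) + 2) := by positivity
    simp only [hldef]; linarith
  choose V hV using fun n => exists_isDiscountedValue (P := P) ρ (l := l n)
    (by linarith [hl0 n]) (hl1 n)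
  set t := Belief.dirac (aheadState P)
  set W : ℕ → Belief P → ℝ := fun n b => V n b - V n t with hW
  have hWC : ∀ n b, |W n b| ≤ C := fun n b => hC (l n) (V n) (hl0 n) (hl1 n) (hV n) b
  let U : Ultrafilter ℕ := Filter.hyperfilter ℕ
  have hlU : Filter.Tendsto l U (nhds 1) := by
    have h1 : Filter.Tendsto (fun n : ℕ => 1 / ((n : ℝ) + 2)) Filter.atTop (nhds 0) :=
      tendsto_const_nhds.div_atTop (Filter.tendsto_atTop_add_const_right _ _
        tendsto_natCast_atTop_atTop)
    have h2 : Filter.Tendsto l Filter.atTop (nhds (1 - 0)) := h1.const_sub 1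
    rw [sub_zero] at h2
    exact h2.mono_left Nat.hyperfilter_le_atTop
  have hbd : ∀ n, |(1 - l n) * V n t| ≤ rewardBound P ρ := fun n => by
    rw [abs_mul, abs_of_pos (sub_pos.2 (hl1 n))]
    exact (hV n).bound t
  obtain ⟨g, -, hg⟩ := exists_tendsto_ultrafilter U hbd
  choose h hhC hh using fun b => exists_tendsto_ultrafilter U fun n => hWC n b
  have hexp : ∀ (b : Belief P) a, Filter.Tendsto
      (fun n => b.gain ρ a + l n * b.expect a (W n)) U (nhds (b.gain ρ a + b.expect a h)) := by
    intro b a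
    have h1 : Filter.Tendsto (fun n => b.expect a (W n)) U (nhds (b.expect a h)) :=
      tendsto_finsetSum _ fun o _ => (hh _).const_mul _
    simpa using (hlU.mul h1).const_add (b.gain ρ a)
  have hlhs : ∀ b, Filter.Tendsto (fun n => (1 - l n) * V n t + W n b) U (nhds (g + h b)) :=
    fun b => hg.add (hh b)
  -- In terms of the relative values `W`, the optimality equation has bounded coefficients.
  have hshift : ∀ n (b : Belief P) a, b.gain ρ a + l n * b.expect a (V n) =
      b.gain ρ a + l n * b.expect a (W n) + l n * V n t := fun n b a => by
    simp only [hW, b.expect_sub, b.expect_const]; ring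
  have hle : ∀ b a, Available P b.obs a → b.gain ρ a + b.expect a h ≤ g + h b := by
    intro b a ha
    refine le_of_tendsto_of_tendsto' (hexp b a) (hlhs b) fun n => ?_
    have h1 := (hV n).ge b a ha
    rw [hshift] at h1
    simp only [hW] at h1 ⊢
    linarith
  have hex : ∀ b, ∃ a, Available P b.obs a ∧ b.gain ρ a + b.expect a h = g + h b := by
    intro b
    choose a ha hVa using fun n => (hV n).attained b
    -- Only finitely many actions are available, so one of them is optimal along the ultrafilter.
    have hfin : ∃ x ∈ (b.available : Set Action), ∀ᶠ n in (U : Filter ℕ), a n = x := by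
      rw [← Ultrafilter.eventually_exists_mem_iff b.available.finite_toSet]
      exact Filter.Eventually.of_forall fun n =>
        ⟨a n, (b.mem_available _).2 (ha n), rfl⟩
    obtain ⟨x, hx, hxU⟩ := hfin
    refine ⟨x, (b.mem_available x).1 hx, tendsto_nhds_unique ((hexp b x).congr' ?_) (hlhs b)⟩
    filter_upwards [hxU] with n hn
    have h1 := hVa n
    rw [hn, hshift] at h1
    simp only [hW] at h1 ⊢
    linarith
  choose φ hφ hφe using hex
  exact ⟨g, C, h, φ, hhC, hφ, hle, hφe⟩

/-! ### A strong law for martingales with bounded increments -/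

/-- If `N` has bounded increments to which `N` and `N ^ 3` are orthogonal, then the fourth moment of
`N n` grows at most like `n ^ 2`. -/
lemma integral_pow_four_le {Ω : Type*} [MeasurableSpace Ω] {μ : Measure Ω}
    [IsProbabilityMeasure μ] {N : ℕ → Ω → ℝ} {B : ℝ} (hB : 0 ≤ B)
    (hm : ∀ n, Measurable (N n)) (h0 : ∀ ω, N 0 ω = 0)
    (hb : ∀ n ω, |N (n + 1) ω - N n ω| ≤ B)
    (h1 : ∀ n, ∫ ω, N n ω * (N (n + 1) ω - N n ω) ∂μ = 0)
    (h3 : ∀ n, ∫ ω, N n ω ^ 3 * (N (n + 1) ω - N n ω) ∂μ = 0) (n : ℕ) :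
    Integrable (fun ω => N n ω ^ 4) μ ∧ ∫ ω, N n ω ^ 4 ∂μ ≤ 4 * B ^ 4 * (n : ℝ) ^ 2 := by
  have hN : ∀ n ω, |N n ω| ≤ B * n := by
    intro n ω
    induction n with
    | zero => simp [h0]
    | succ n ih =>
      have := abs_add_le (N n ω) (N (n + 1) ω - N n ω)
      rw [add_sub_cancel] at this
      have := hb n ω
      push_cast
      linarith
  have hint : ∀ (n k j : ℕ), Integrable (fun ω => N n ω ^ k * (N (n + 1) ω - N n ω) ^ j) μ := by
    intro n k j
    refine Integrable.of_bound (((hm n).pow_const k).mul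
      (((hm (n + 1)).sub (hm n)).pow_const j)).aestronglyMeasurable ((B * n) ^ k * B ^ j)
      (Filter.Eventually.of_forall fun ω => ?_)
    rw [Real.norm_eq_abs, abs_mul, abs_pow, abs_pow]
    have := hN n ω
    have := hb n ω
    gcongr
  have hint0 : ∀ n k : ℕ, Integrable (fun ω => N n ω ^ k) μ := fun n k => by
    simpa using hint n k 0
  have hsq : ∀ n ω, (N (n + 1) ω - N n ω) ^ 2 ≤ B ^ 2 := fun n ω =>
    sq_le_sq' (abs_le.1 (hb n ω)).1 (abs_le.1 (hb n ω)).2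
  have h2 : ∀ n : ℕ, ∫ ω, N n ω ^ 2 ∂μ ≤ B ^ 2 * n := by
    intro n
    induction n with
    | zero => simp [h0]
    | succ n ih =>
      have hle : ∀ ω, N (n + 1) ω ^ 2 ≤
          N n ω ^ 2 + 2 * (N n ω * (N (n + 1) ω - N n ω)) + B ^ 2 := fun ω => by
        have := hsq n ω
        nlinarith
      have hi1 := hint0 n 2
      have hi2 : Integrable (fun ω => 2 * (N n ω * (N (n + 1) ω - N n ω))) μ := by
        simpa using (hint n 1 1).const_mul 2
      have := integral_mono (hint0 (n + 1) 2) ((hi1.add hi2).add (integrable_const _)) hle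
      rw [integral_add' (hi1.add hi2) (integrable_const _), integral_add' hi1 hi2,
        integral_const_mul, h1] at this
      simp only [integral_const, probReal_univ, smul_eq_mul] at this
      push_cast
      linarith
  refine ⟨hint0 n 4, ?_⟩
  induction n with
  | zero => simp [h0]
  | succ n ih =>
    have hle : ∀ ω, N (n + 1) ω ^ 4 ≤ N n ω ^ 4 + 4 * (N n ω ^ 3 * (N (n + 1) ω - N n ω)) +
        8 * B ^ 2 * N n ω ^ 2 + 3 * B ^ 4 := fun ω => by
      have e1 := hsq n ω
      set x := N n ω
      obtain ⟨d, hd⟩ : ∃ d, d = N (n + 1) ω - x := ⟨_, rfl⟩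
      rw [← hd] at e1 ⊢
      have e2 : N (n + 1) ω = x + d := by rw [hd]; ring
      have e3 : d ^ 4 ≤ B ^ 4 := by
        have := pow_le_pow_left₀ (sq_nonneg d) e1 2
        linarith [show (d ^ 2) ^ 2 = d ^ 4 by ring, show (B ^ 2) ^ 2 = B ^ 4 by ring]
      have e4 := mul_le_mul_of_nonneg_right e1 (sq_nonneg x)
      have e5 : 0 ≤ (d * (x - d)) ^ 2 := sq_nonneg _
      rw [e2]
      have e6 : (x + d) ^ 4 = x ^ 4 + 4 * (x ^ 3 * d) + 8 * (d ^ 2 * x ^ 2) + 3 * d ^ 4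
          - 2 * (d * (x - d)) ^ 2 := by ring
      linarith
    have hi1 := hint0 n 4
    have hi2 : Integrable (fun ω => 4 * (N n ω ^ 3 * (N (n + 1) ω - N n ω))) μ := by
      simpa using (hint n 3 1).const_mul 4
    have hi3 : Integrable (fun ω => 8 * B ^ 2 * N n ω ^ 2) μ := (hint0 n 2).const_mul _
    have := integral_mono (hint0 (n + 1) 4) (((hi1.add hi2).add hi3).add (integrable_const _)) hle
    rw [integral_add' ((hi1.add hi2).add hi3) (integrable_const _),
      integral_add' (hi1.add hi2) hi3, integral_add' hi1 hi2,
      integral_const_mul, integral_const_mul, h3] at this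
    simp only [integral_const, probReal_univ, smul_eq_mul] at this
    have h4 := mul_le_mul_of_nonneg_left (h2 n) (show 0 ≤ 8 * B ^ 2 by positivity)
    have h5 : 0 ≤ B ^ 4 := by positivity
    push_cast
    nlinarith

/-- Since `∑ n, 𝔼[(N n / n) ^ 4]` is finite, `N n / n` tends to `0` almost surely. -/
lemma ae_tendsto_div_zero {Ω : Type*} [MeasurableSpace Ω] {μ : Measure Ω}
    [IsProbabilityMeasure μ] {N : ℕ → Ω → ℝ} {B : ℝ} (hB : 0 ≤ B)
    (hm : ∀ n, Measurable (N n)) (h0 : ∀ ω, N 0 ω = 0)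
    (hb : ∀ n ω, |N (n + 1) ω - N n ω| ≤ B)
    (h1 : ∀ n, ∫ ω, N n ω * (N (n + 1) ω - N n ω) ∂μ = 0)
    (h3 : ∀ n, ∫ ω, N n ω ^ 3 * (N (n + 1) ω - N n ω) ∂μ = 0) :
    ∀ᵐ ω ∂μ, Filter.Tendsto (fun n : ℕ => N n ω / n) Filter.atTop (nhds 0) := by
  have h4 := integral_pow_four_le hB hm h0 hb h1 h3
  have hmeas : ∀ n : ℕ, Measurable fun ω => ENNReal.ofReal ((N n ω / n) ^ 4) := fun n =>
    (((hm n).div_const _).pow_const 4).ennreal_ofReal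
  have hle : ∀ n : ℕ, ∫⁻ ω, ENNReal.ofReal ((N n ω / n) ^ 4) ∂μ ≤
      ENNReal.ofReal (4 * B ^ 4 * (1 / (n : ℝ) ^ 2)) := by
    intro n
    have hi : Integrable (fun ω => (N n ω / n) ^ 4) μ := by
      simpa only [div_pow] using (h4 n).1.div_const ((n : ℝ) ^ 4)
    rw [← ofReal_integral_eq_lintegral_ofReal hi
      (Filter.Eventually.of_forall fun ω => by positivity)]
    refine ENNReal.ofReal_le_ofReal ?_
    simp only [div_pow, integral_div]
    rcases Nat.eq_zero_or_pos n with rfl | hn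
    · simp
    · have hn' : (0 : ℝ) < n := by exact_mod_cast hn
      rw [div_le_iff₀ (by positivity)]
      refine (h4 n).2.trans (le_of_eq ?_)
      field_simp
  have hsum : ∑' n : ℕ, ENNReal.ofReal (4 * B ^ 4 * (1 / (n : ℝ) ^ 2)) ≠ ⊤ :=
    ((Real.summable_one_div_nat_pow.2 one_lt_two).mul_left _).tsum_ofReal_ne_top
  have hfin : ∫⁻ ω, ∑' n : ℕ, ENNReal.ofReal ((N n ω / n) ^ 4) ∂μ ≠ ⊤ := by
    rw [lintegral_tsum fun n => (hmeas n).aemeasurable]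
    exact ne_top_of_le_ne_top hsum (ENNReal.tsum_le_tsum hle)
  filter_upwards [ae_lt_top (Measurable.tsum hmeas) hfin] with ω hω
  have ht := ENNReal.tendsto_atTop_zero_of_tsum_ne_top hω.ne
  have ht' := (ENNReal.tendsto_toReal ENNReal.zero_ne_top).comp ht
  rw [ENNReal.toReal_zero] at ht'
  have ht2 : Filter.Tendsto (fun n : ℕ => (N n ω / n) ^ 4) Filter.atTop (nhds 0) :=
    ht'.congr fun n => ENNReal.toReal_ofReal (by positivity)
  have ht3 := ht2.sqrt.sqrt
  rw [Real.sqrt_zero, Real.sqrt_zero] at ht3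
  refine (tendsto_zero_iff_abs_tendsto_zero _).2 (ht3.congr fun n => ?_)
  rw [show (N n ω / n) ^ 4 = ((N n ω / n) ^ 2) ^ 2 by ring, Real.sqrt_sq (sq_nonneg _),
    Real.sqrt_sq_eq_abs]
  rfl

/-! ### The law of a run -/

lemma history_zero (ω : ℕ → Step) : history ω 0 = [] := by simp [history]

lemma history_succ (ω : ℕ → Step) (n : ℕ) :
    history ω (n + 1) = ω (n + 1) :: history ω n := by
  simp [history, List.ofFn_succ]

/-- The first `n` steps of a run, continued arbitrarily. -/
def extend (n : ℕ) (x : Π _ : Finset.Iic n, Step) : ℕ → Step :=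
  fun k => if hk : k ∈ Finset.Iic n then x ⟨k, hk⟩ else x ⟨0, by simp⟩

lemma history_extend (ω : ℕ → Step) (n : ℕ) :
    history (extend n (Preorder.frestrictLe n ω)) n = history ω n := by
  unfold history
  congr 1
  funext i
  have : n - (i : ℕ) ∈ Finset.Iic n := by simp
  simp [extend, Preorder.frestrictLe]

lemma measurable_history {β : Type*} [MeasurableSpace β] (F : List Step → β) (n : ℕ) :
    Measurable fun ω : ℕ → Step => F (history ω n) := by
  have h : (fun ω : ℕ → Step => F (history ω n)) =
      (fun x : Π _ : Finset.Iic n, Step => F (history (extend n x) n)) ∘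
        Preorder.frestrictLe n := by
    funext ω
    simp [history_extend]
  rw [h]
  exact (measurable_of_countable _).comp (Preorder.measurable_frestrictLe n)

instance (b : Belief P) (π : Policy) : IsProbabilityMeasure (runLaw b π) := by
  unfold runLaw; infer_instance

/-- Given the history, the next step has the law `stepLaw`. -/
lemma integral_step (b : Belief P) (π : Policy) (n : ℕ) (F : List Step → Step → ℝ) {C : ℝ}
    (hF : ∀ h y, |F h y| ≤ C) :
    ∫ ω, F (history ω n) (ω (n + 1)) ∂runLaw b π =
      ∫ ω, ∫ y, F (history ω n) y ∂(stepLaw b π (history ω n)).toMeasure ∂runLaw b π := by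
  let f : (Π _ : Finset.Iic n, Step) × Step → ℝ := fun z => F (history (extend n z.1) n) z.2
  have hf : Measurable f := measurable_of_countable f
  have hmap := Kernel.partialTraj_compProd_eq_map_traj (X := fun _ => Step)
    (κ := stepKernel b π) (Nat.zero_le n) (x₀ := fun _ => (Action.adopt, b.obs))
  have hmap' := Kernel.traj_map_frestrictLe_apply (X := fun _ => Step) (κ := stepKernel b π) 0 n
    (fun _ => (Action.adopt, b.obs))
  calc ∫ ω, F (history ω n) (ω (n + 1)) ∂runLaw b π
      = ∫ ω, f (Preorder.frestrictLe n ω, ω (n + 1)) ∂runLaw b π := by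
        simp only [f, history_extend]
    _ = ∫ z, f z ∂((runLaw b π).map fun ω => (Preorder.frestrictLe n ω, ω (n + 1))) := by
        rw [integral_map]
        · fun_prop
        · exact hf.aestronglyMeasurable
    _ = ∫ x, ∫ y, f (x, y) ∂stepKernel b π n x ∂((runLaw b π).map (Preorder.frestrictLe n)) := by
        unfold runLaw
        rw [hmap', ← hmap, Measure.integral_compProd]
        exact Integrable.of_bound hf.aestronglyMeasurable C
          (Filter.Eventually.of_forall fun z => hF _ _)
    _ = ∫ ω, ∫ y, f (Preorder.frestrictLe n ω, y)
          ∂stepKernel b π n (Preorder.frestrictLe n ω) ∂runLaw b π := by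
        rw [integral_map]
        · fun_prop
        · exact (measurable_of_countable _).aestronglyMeasurable
    _ = _ := by
        have hk : ∀ x, stepKernel b π n x = (stepLaw b π (history (extend n x) n)).toMeasure :=
          fun x => rfl
        simp only [hk, f, history_extend]

lemma stepLaw_apply (b : Belief P) (π : Policy) (h : List Step) (a : Action) (o : Obs) :
    stepLaw b π h (a, o) = π h a * (b.after h).obsLaw a o := by
  unfold stepLaw
  rw [PMF.bind_apply, tsum_eq_single a]
  · congr 1
    rw [PMF.map_apply, tsum_eq_single o]
    · simp
    · intro o' ho'
      simp [ho'.symm]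
  · intro a' ha'
    refine mul_eq_zero_of_right _ ?_
    rw [PMF.map_apply, ENNReal.tsum_eq_zero]
    intro o'
    simp [ha'.symm]

lemma integrable_toMeasure_of_abs_le {α : Type*} [Countable α] [MeasurableSpace α]
    [DiscreteMeasurableSpace α] (p : PMF α) {f : α → ℝ} {C : ℝ}
    (hf : ∀ y, |f y| ≤ C) : Integrable f p.toMeasure :=
  Integrable.of_bound (measurable_of_countable f).aestronglyMeasurable C
    (Filter.Eventually.of_forall hf)

/-- The conditional expectation of a step is the average over the actions of the policy of the
expectations over the next observation. -/
lemma integral_stepLaw_le (b : Belief P) (π : Policy) (h : List Step) {F : Step → ℝ} {C K : ℝ}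
    (hF : ∀ y, |F y| ≤ C)
    (hK : ∀ a ∈ (π h).support,
      ∑ o ∈ observations P, (b.after h).obsProb a o * F (a, o) ≤ K) :
    ∫ y, F y ∂(stepLaw b π h).toMeasure ≤ K := by
  have hi := integrable_toMeasure_of_abs_le (stepLaw b π h) hF
  have hsum : Summable fun y => (stepLaw b π h y).toReal * F y := by
    refine Summable.of_norm_bounded (g := fun y => (stepLaw b π h y).toReal * C)
      ((ENNReal.summable_toReal (stepLaw b π h).tsum_coe_ne_top).mul_right C) fun y => ?_
    rw [norm_mul, Real.norm_of_nonneg ENNReal.toReal_nonneg]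
    exact mul_le_mul_of_nonneg_left (hF y) ENNReal.toReal_nonneg
  have hsumπ : Summable fun a => (π h a).toReal := ENNReal.summable_toReal (π h).tsum_coe_ne_top
  have hinner : ∀ a, ∑' o, (stepLaw b π h (a, o)).toReal * F (a, o) =
      (π h a).toReal * ∑ o ∈ observations P, (b.after h).obsProb a o * F (a, o) := by
    intro a
    have e : ∀ o, (stepLaw b π h (a, o)).toReal * F (a, o) =
        (π h a).toReal * ((b.after h).obsProb a o * F (a, o)) := fun o => by
      rw [stepLaw_apply, ENNReal.toReal_mul, Belief.obsLaw_apply,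
        ENNReal.toReal_ofReal (Belief.obsProb_nonneg _ _ _), mul_assoc]
    simp only [e]
    rw [tsum_mul_left, tsum_eq_sum fun o ho => by rw [Belief.obsProb_eq_zero _ _ ho, zero_mul]]
  have hone : ∑' a, (π h a).toReal = 1 := by
    rw [← ENNReal.tsum_toReal_eq fun a => (π h).apply_ne_top a, (π h).tsum_coe,
      ENNReal.toReal_one]
  rw [PMF.integral_eq_tsum _ _ hi]
  simp only [smul_eq_mul]
  rw [hsum.tsum_prod]
  simp only [hinner]
  calc ∑' a, (π h a).toReal * ∑ o ∈ observations P, (b.after h).obsProb a o * F (a, o)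
      ≤ ∑' a, (π h a).toReal * K := by
        refine Summable.tsum_le_tsum (fun a => ?_) ?_ (hsumπ.mul_right K)
        · by_cases ha : a ∈ (π h).support
          · exact mul_le_mul_of_nonneg_left (hK a ha) ENNReal.toReal_nonneg
          · simp [(π h).apply_eq_zero_iff a |>.2 ha]
        · simpa only [hinner] using hsum.prod
    _ = K := by rw [tsum_mul_right, hone, one_mul]

/-- Admissible policies almost surely take available actions only. -/
lemma ae_available (b : Belief P) (π : Policy) (hπ : π.Admissible P b) :
    ∀ᵐ ω ∂runLaw b π, ∀ n, Available P (b.after (history ω n)).obs (ω (n + 1)).1 := by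
  classical
  rw [ae_all_iff]
  intro n
  let F : List Step → Step → ℝ := fun h y => if Available P (b.after h).obs y.1 then 0 else 1
  have hF0 : ∀ h y, 0 ≤ F h y := fun h y => by simp only [F]; split_ifs <;> simp
  have hF1 : ∀ h y, |F h y| ≤ 1 := fun h y => by simp only [F]; split_ifs <;> simp
  have hm : Measurable fun ω : ℕ → Step => F (history ω n) (ω (n + 1)) := by
    have := measurable_history (fun l => match l with | [] => (0 : ℝ) | y :: h => F h y) (n + 1)
    simpa only [history_succ] using this
  have h1 : ∫ ω, F (history ω n) (ω (n + 1)) ∂runLaw b π ≤ 0 := by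
    rw [integral_step b π n F hF1]
    refine integral_nonpos fun ω => integral_stepLaw_le b π _ (hF1 _) fun a ha => ?_
    have := hπ _ a ha
    simp [F, this]
  have h2 := (integral_eq_zero_iff_of_nonneg (fun ω => hF0 (history ω n) (ω (n + 1)))
    (Integrable.of_bound hm.aestronglyMeasurable 1
      (Filter.Eventually.of_forall fun ω => hF1 _ _))).1
    (le_antisymm h1 (integral_nonneg fun ω => hF0 _ _))
  filter_upwards [h2] with ω hω
  by_contra hne
  simp [F, hne] at hω

/-! ### Average rewards along a run -/

section Run

open Classical in
/-- The expected reward of a slot, set to `0` for unavailable actions so that it is bounded. -/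
def Belief.cutGain (ρ : ℝ) (b : Belief P) (a : Action) : ℝ :=
  if Available P b.obs a then b.gain ρ a else 0

lemma Belief.abs_cutGain_le (ρ : ℝ) (b : Belief P) (a : Action) :
    |b.cutGain ρ a| ≤ rewardBound P ρ := by
  unfold Belief.cutGain
  split_ifs with h
  · exact b.abs_gain_le ρ h
  · simpa using rewardBound_nonneg P ρ

variable (ρ g : ℝ) (h : Belief P → ℝ) (b : Belief P) (π : Policy)

/-- The surplus of a slot over the optimality equation: reward minus `g` plus the change of the
relative value. -/
def surplus (l : List Step) (y : Step) : ℝ :=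
  (b.after l).cutGain ρ y.1 - g + h (b.after (y :: l)) - h (b.after l)

/-- The expected surplus given the history. -/
def meanSurplus (l : List Step) : ℝ :=
  ∫ y, surplus ρ g h b l y ∂(stepLaw b π l).toMeasure

/-- The sum of the centred surpluses along a history: a martingale. -/
def centred : List Step → ℝ
  | [] => 0
  | y :: l => centred l + (surplus ρ g h b l y - meanSurplus ρ g h b π l)

variable {ρ g h} {C : ℝ}

lemma abs_surplus_le (hC : ∀ b, |h b| ≤ C) (l : List Step) (y : Step) :
    |surplus ρ g h b l y| ≤ rewardBound P ρ + |g| + 2 * C := by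
  have h1 := abs_le.1 ((b.after l).abs_cutGain_le ρ y.1)
  have h2 := abs_le.1 (hC (b.after l))
  have h3 := abs_le.1 (hC (b.after (y :: l)))
  have h4 := le_abs_self g
  have h5 := neg_abs_le g
  unfold surplus
  rw [abs_le]
  constructor <;> linarith

lemma abs_meanSurplus_le (hC : ∀ b, |h b| ≤ C) (l : List Step) :
    |meanSurplus ρ g h b π l| ≤ rewardBound P ρ + |g| + 2 * C := by
  have := norm_integral_le_of_norm_le_const (μ := (stepLaw b π l).toMeasure)
    (Filter.Eventually.of_forall fun y => (Real.norm_eq_abs _).le.trans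
      (abs_surplus_le b (ρ := ρ) (g := g) hC l y))
  simpa [meanSurplus] using this

lemma abs_centred_le (hC : ∀ b, |h b| ≤ C) (l : List Step) :
    |centred ρ g h b π l| ≤ l.length * (2 * (rewardBound P ρ + |g| + 2 * C)) := by
  induction l with
  | nil => simp [centred]
  | cons y l ih =>
    have h1 := abs_add_le (centred ρ g h b π l)
      (surplus ρ g h b l y - meanSurplus ρ g h b π l)
    have h2 := abs_sub (surplus ρ g h b l y) (meanSurplus ρ g h b π l)
    have h3 := abs_surplus_le b (ρ := ρ) (g := g) hC l y
    have h4 := abs_meanSurplus_le b π (ρ := ρ) (g := g) hC l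
    simp only [centred, List.length_cons]
    push_cast
    linarith

lemma length_history (ω : ℕ → Step) (n : ℕ) : (history ω n).length = n := by simp [history]

/-- Any function of the past is orthogonal to the next centred surplus. -/
lemma integral_mul_centred (hC : ∀ b, |h b| ≤ C) (n k : ℕ) :
    ∫ ω, centred ρ g h b π (history ω n) ^ k *
      (surplus ρ g h b (history ω n) (ω (n + 1)) - meanSurplus ρ g h b π (history ω n))
      ∂runLaw b π = 0 := by
  set B := rewardBound P ρ + |g| + 2 * C
  -- The formula for the next step needs a bounded integrand: histories of other lengths are cut off.
  let F : List Step → Step → ℝ := fun l y => if l.length = n then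
    centred ρ g h b π l ^ k * (surplus ρ g h b l y - meanSurplus ρ g h b π l) else 0
  have hd : ∀ l y, |surplus ρ g h b l y - meanSurplus ρ g h b π l| ≤ 2 * B := fun l y => by
    have h2 := abs_sub (surplus ρ g h b l y) (meanSurplus ρ g h b π l)
    have h3 := abs_surplus_le b (ρ := ρ) (g := g) hC l y
    have h4 := abs_meanSurplus_le b π (ρ := ρ) (g := g) hC l
    linarith
  have hB : 0 ≤ 2 * B := (abs_nonneg _).trans (hd [] (Action.adopt, b.obs))
  have hF : ∀ l y, |F l y| ≤ (n * (2 * B)) ^ k * (2 * B) := fun l y => by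
    simp only [F]
    split_ifs with hl
    · rw [abs_mul, abs_pow]
      have h1 := abs_centred_le b π (ρ := ρ) (g := g) hC l
      rw [hl] at h1
      have h2 := hd l y
      gcongr
    · rw [abs_zero]; positivity
  have h1 := integral_step b π n F hF
  simp only [F, length_history, if_true] at h1
  rw [h1]
  refine integral_eq_zero_of_ae (Filter.Eventually.of_forall fun ω => ?_)
  have hi := integrable_toMeasure_of_abs_le (stepLaw b π (history ω n))
    (abs_surplus_le b (ρ := ρ) (g := g) hC (history ω n))
  simp only [Pi.zero_apply]
  rw [integral_const_mul, integral_sub hi (integrable_const _)]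
  simp [meanSurplus]

lemma ae_tendsto_centred (hC : ∀ b, |h b| ≤ C) :
    ∀ᵐ ω ∂runLaw b π, Filter.Tendsto (fun n : ℕ => centred ρ g h b π (history ω n) / n)
      Filter.atTop (nhds 0) := by
  have hd : ∀ l y, |surplus ρ g h b l y - meanSurplus ρ g h b π l| ≤
      2 * (rewardBound P ρ + |g| + 2 * C) := fun l y => by
    have h2 := abs_sub (surplus ρ g h b l y) (meanSurplus ρ g h b π l)
    have h3 := abs_surplus_le b (ρ := ρ) (g := g) hC l y
    have h4 := abs_meanSurplus_le b π (ρ := ρ) (g := g) hC l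
    linarith
  have e : ∀ (ω : ℕ → Step) n, centred ρ g h b π (history ω (n + 1)) -
      centred ρ g h b π (history ω n) =
      surplus ρ g h b (history ω n) (ω (n + 1)) - meanSurplus ρ g h b π (history ω n) :=
    fun ω n => by simp [history_succ, centred]
  refine ae_tendsto_div_zero ((abs_nonneg _).trans (hd [] (Action.adopt, b.obs)))
    (fun n => measurable_history _ n) (fun ω => by simp [history_zero, centred])
    (fun n ω => by rw [e]; exact hd _ _) (fun n => ?_) (fun n => ?_)
  · simpa only [e, pow_one] using integral_mul_centred b π (ρ := ρ) (g := g) hC n 1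
  · simpa only [e] using integral_mul_centred b π (ρ := ρ) (g := g) hC n 3

lemma sum_cutGain_eq (ω : ℕ → Step) (n : ℕ) :
    ∑ i ∈ Finset.range n, (b.after (history ω i)).cutGain ρ (ω (i + 1)).1 =
      n * g + centred ρ g h b π (history ω n) +
        ∑ i ∈ Finset.range n, meanSurplus ρ g h b π (history ω i) +
        (h b - h (b.after (history ω n))) := by
  induction n with
  | zero => simp [history_zero, centred, Belief.after]
  | succ n ih =>
    rw [Finset.sum_range_succ, Finset.sum_range_succ, ih, history_succ]
    simp only [centred, surplus]
    push_cast
    ring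

variable {φ : Belief P → Action}

lemma IsAverageSolution.stationary_admissible (hs : IsAverageSolution P ρ g C h φ) :
    (stationary b φ).Admissible P b := by
  intro l a ha
  simp only [stationary, PMF.support_pure, Set.mem_singleton_iff] at ha
  rw [ha]
  exact hs.available _

/-- The expected surplus of an admissible policy is not positive. -/
lemma IsAverageSolution.meanSurplus_nonpos (hs : IsAverageSolution P ρ g C h φ)
    (hπ : π.Admissible P b) (l : List Step) : meanSurplus ρ g h b π l ≤ 0 := by
  refine integral_stepLaw_le b π l (abs_surplus_le b hs.bound l) fun a ha => ?_
  have hav := hπ l a ha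
  have h1 := hs.le _ a hav
  have h2 := (b.after l).expect_add a (fun _ => (b.after l).gain ρ a - g - h (b.after l)) h
  rw [Belief.expect_const] at h2
  have h3 : ∑ o ∈ observations P, (b.after l).obsProb a o * surplus ρ g h b l (a, o) =
      (b.after l).expect a fun x => (b.after l).gain ρ a - g - h (b.after l) + h x := by
    refine Finset.sum_congr rfl fun o _ => ?_
    simp only [surplus, Belief.cutGain, hav, if_true, Belief.after]
    ring
  rw [h3, h2]
  linarith

/-- The expected surplus of the policy that attains the optimality equation vanishes. -/
lemma IsAverageSolution.meanSurplus_stationary (hs : IsAverageSolution P ρ g C h φ)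
    (l : List Step) : meanSurplus ρ g h b (stationary b φ) l = 0 := by
  refine le_antisymm (hs.meanSurplus_nonpos b _ (hs.stationary_admissible b) l) ?_
  have hneg : ∫ y, -surplus ρ g h b l y ∂(stepLaw b (stationary b φ) l).toMeasure ≤ 0 := by
    refine integral_stepLaw_le b _ l (fun y => by
      rw [abs_neg]; exact abs_surplus_le b hs.bound l y) fun a ha => ?_
    simp only [stationary, PMF.support_pure, Set.mem_singleton_iff] at ha
    subst ha
    have hav := hs.available (b.after l)
    have h1 := hs.eq (b.after l)
    have h2 := (b.after l).expect_sub (φ (b.after l))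
      (fun _ => g + h (b.after l) - (b.after l).gain ρ (φ (b.after l))) h
    rw [Belief.expect_const] at h2
    have h3 : ∑ o ∈ observations P, (b.after l).obsProb (φ (b.after l)) o *
        -surplus ρ g h b l (φ (b.after l), o) = (b.after l).expect (φ (b.after l)) fun x =>
          g + h (b.after l) - (b.after l).gain ρ (φ (b.after l)) - h x := by
      refine Finset.sum_congr rfl fun o _ => ?_
      simp only [surplus, Belief.cutGain, hav, if_true, Belief.after]
      ring
    rw [h3, h2]
    linarith
  rw [integral_neg] at hneg
  unfold meanSurplus
  linarith

variable (ρ) in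
/-- The average reward of the first `n` slots of a run. -/
def average (ω : ℕ → Step) (n : ℕ) : ℝ :=
  (1 / (n : ℝ)) * ∑ i ∈ Finset.range n, (b.after (history ω i)).gain ρ (ω (i + 1)).1

lemma IsAverageSolution.ae_average_eq (hs : IsAverageSolution P ρ g C h φ)
    (hπ : π.Admissible P b) :
    ∀ᵐ ω ∂runLaw b π, ∃ u : ℕ → ℝ, Filter.Tendsto u Filter.atTop (nhds g) ∧
      ∀ n, 0 < n → average ρ b ω n = u n +
        (1 / (n : ℝ)) * ∑ i ∈ Finset.range n, meanSurplus ρ g h b π (history ω i) := by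
  filter_upwards [ae_available b π hπ, ae_tendsto_centred b π (ρ := ρ) (g := g) hs.bound]
    with ω hav hlim
  refine ⟨fun n => g + centred ρ g h b π (history ω n) / n +
    (h b - h (b.after (history ω n))) / n, ?_, fun n hn => ?_⟩
  · have h1 : Filter.Tendsto (fun n : ℕ => (h b - h (b.after (history ω n))) / (n : ℝ))
        Filter.atTop (nhds 0) := by
      refine squeeze_zero_norm (a := fun n : ℕ => 2 * C / n) (fun n => ?_)
        (tendsto_const_div_atTop_nhds_zero_nat _)
      rw [norm_div, Real.norm_natCast, Real.norm_eq_abs]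
      have h2 := abs_sub (h b) (h (b.after (history ω n)))
      have h3 := hs.bound b
      have h4 := hs.bound (b.after (history ω n))
      gcongr
      linarith
    simpa using (hlim.const_add g).add h1
  · have h1 : ∑ i ∈ Finset.range n, (b.after (history ω i)).gain ρ (ω (i + 1)).1 =
        ∑ i ∈ Finset.range n, (b.after (history ω i)).cutGain ρ (ω (i + 1)).1 :=
      Finset.sum_congr rfl fun i _ => by rw [Belief.cutGain, if_pos (hav i)]
    have hn' : (n : ℝ) ≠ 0 := by exact_mod_cast hn.ne'
    rw [average, h1, sum_cutGain_eq (g := g) (h := h) b π]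
    field_simp
    ring

lemma measurable_liminf_average :
    Measurable fun ω => Filter.liminf (average ρ b ω) Filter.atTop := by
  refine Measurable.liminf fun n => ?_
  refine (Finset.measurable_sum _ fun i _ => ?_).const_mul _
  have := measurable_history (fun l => match l with
    | [] => (0 : ℝ)
    | y :: l => (b.after l).gain ρ y.1) (i + 1)
  simpa only [history_succ] using this

/-- Almost surely the averages are eventually bounded, so their lower limit is no junk value. -/
lemma abs_average_le {ω : ℕ → Step}
    (hav : ∀ n, Available P (b.after (history ω n)).obs (ω (n + 1)).1) (n : ℕ) :
    |average ρ b ω n| ≤ rewardBound P ρ := by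
  rcases Nat.eq_zero_or_pos n with rfl | hn
  · simpa [average] using rewardBound_nonneg P ρ
  have hn' : (0 : ℝ) < n := by exact_mod_cast hn
  rw [average, abs_mul, abs_of_pos (by positivity), one_div, inv_mul_le_iff₀ hn']
  refine (Finset.abs_sum_le_sum_abs _ _).trans ?_
  have := Finset.sum_le_card_nsmul (Finset.range n)
    (fun i => |(b.after (history ω i)).gain ρ (ω (i + 1)).1|) (rewardBound P ρ)
    fun i _ => Belief.abs_gain_le ρ _ (hav i)
  simpa using this

/-- No admissible policy has a larger average reward than `g`. -/
lemma IsAverageSolution.value_le (hs : IsAverageSolution P ρ g C h φ) (hπ : π.Admissible P b) :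
    value ρ b π ≤ g := by
  have hbd : ∀ᵐ ω ∂runLaw b π, -rewardBound P ρ ≤
      Filter.liminf (average ρ b ω) Filter.atTop ∧
      Filter.liminf (average ρ b ω) Filter.atTop ≤ g := by
    filter_upwards [ae_available b π hπ, hs.ae_average_eq b π hπ] with ω hav ⟨u, hu, hau⟩
    have hbelow : Filter.IsBoundedUnder (· ≥ ·) Filter.atTop (average ρ b ω) :=
      Filter.isBoundedUnder_of ⟨_, fun n => (abs_le.1 (abs_average_le b (ρ := ρ) hav n)).1⟩
    have habove : Filter.IsBoundedUnder (· ≤ ·) Filter.atTop (average ρ b ω) :=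
      Filter.isBoundedUnder_of ⟨_, fun n => (abs_le.1 (abs_average_le b (ρ := ρ) hav n)).2⟩
    constructor
    · exact Filter.le_liminf_of_le habove.isCoboundedUnder_ge
        (Filter.Eventually.of_forall fun n => (abs_le.1 (abs_average_le b (ρ := ρ) hav n)).1)
    · rw [← hu.liminf_eq]
      refine Filter.liminf_le_liminf ?_ hbelow hu.isBoundedUnder_le.isCoboundedUnder_ge
      filter_upwards [Filter.eventually_gt_atTop 0] with n hn
      rw [hau n hn, add_le_iff_nonpos_right]
      exact mul_nonpos_of_nonneg_of_nonpos (by positivity)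
        (Finset.sum_nonpos fun i _ => hs.meanSurplus_nonpos b π hπ _)
  have hint : Integrable (fun ω => Filter.liminf (average ρ b ω) Filter.atTop) (runLaw b π) :=
    Integrable.of_bound (measurable_liminf_average b).aestronglyMeasurable
      (max (rewardBound P ρ) |g|) (by
        filter_upwards [hbd] with ω hω
        exact abs_le.2 ⟨(neg_le_neg (le_max_left _ _)).trans hω.1,
          hω.2.trans ((le_abs_self g).trans (le_max_right _ _))⟩)
  have h1 := integral_mono_ae hint (integrable_const g) (hbd.mono fun ω hω => hω.2)
  rw [integral_const, probReal_univ, one_smul] at h1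
  exact h1

/-- The policy that attains the optimality equation has average reward `g`. -/
lemma IsAverageSolution.value_stationary (hs : IsAverageSolution P ρ g C h φ) :
    value ρ b (stationary b φ) = g := by
  have h1 : ∀ᵐ ω ∂runLaw b (stationary b φ),
      Filter.liminf (average ρ b ω) Filter.atTop = g := by
    filter_upwards [hs.ae_average_eq b _ (hs.stationary_admissible b)] with ω ⟨u, hu, hau⟩
    refine (hu.congr' ?_).liminf_eq
    filter_upwards [Filter.eventually_gt_atTop 0] with n hn
    rw [hau n hn]
    simp [hs.meanSurplus_stationary]
  have h2 := integral_congr_ae h1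
  rw [integral_const, probReal_univ, one_smul] at h2
  exact h2

end Run

end

end SelfishMining

/-- There is an optimal stationary deterministic policy: a map from beliefs to available actions
whose expected average reward is, from every initial belief, at least that of every admissible
(history-dependent, randomized) policy. -/
theorem lemma3 (P : SelfishMining.Params) (ρ : ℝ) (hρ0 : 0 ≤ ρ) (hρ1 : ρ ≤ 1) :
    ∃ φ : SelfishMining.Belief P → SelfishMining.Action,
      (∀ b, SelfishMining.Available P b.obs (φ b)) ∧
      ∀ (b : SelfishMining.Belief P) (π : SelfishMining.Policy),
        SelfishMining.Policy.Admissible P b π →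
          SelfishMining.value ρ b π ≤
            SelfishMining.value ρ b (SelfishMining.stationary b φ) := by
  obtain ⟨g, C, h, φ, hs⟩ := SelfishMining.exists_isAverageSolution P ρ
  refine ⟨φ, hs.available, fun b π hπ => ?_⟩
  rw [hs.value_stationary b]
  exact hs.value_le b π hπ
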